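/- Let $B=\{x\in\mathbb R^5: |x|<1\}$ and $\mathbb S^4=\{x\in\mathbb R^5:|x|=1\}$. Let $h\in W^{1,2}(B;\mathbb R^5)$ be such that, for some $\zeta\in W^{1,2}(\mathbb S^4;\mathbb R^5)$, $h(x)=\frac1{|x|}\zeta\big(\frac x{|x|}\big)$ for a.e. $x\in B$, and let $p\in L^1(B)$ be real-valued. Suppose that $(h,p)$ solves the stationary Euler equations $$\operatorname{div} h=0,\qquad (h\cdot\nabla)h+\nabla p=0\qquad\text{in } B$$ in the sense of distributions, that is, for all $\varphi\in C_c^\infty(B)$ and $i=1,\dots,5$, $$\int_B h\cdot\nabla\varphi\,dx=0,\qquad \int_B\Big(\sum_{j=1}^5 h_j\,\partial_jh_i\Big)\varphi\,dx-\int_B p\,\partial_i\varphi\,dx=0,$$ where $\partial_j h_i$ are the weak derivatives of $h$. Then there exist a constant $p_0\in\mathbb R$ and a function $\xi\in W^{1,5/4}(\mathbb S^4)$ such that $$p(x)=\frac1{|x|^2}\,\xi\Big(\frac x{|x|}\Big)+p_0\qquad\text{for a.e. } x\in B.$$ Here $W^{1,q}(\mathbb S^4)$ is the space of functions in $L^q(\mathbb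 S^4)$, with respect to surface measure, whose weak Riemannian gradient on $\mathbb S^4$ is in $L^q$; for vector-valued functions it is understood componentwise. -/

import Mathlib

open MeasureTheory Metric TopologicalSpace
open scoped ENNReal ContDiff Distributions RealInnerProductSpace

noncomputable section

/-- Euclidean space `ℝⁿ`. -/
abbrev Euc (n : ℕ) : Type := EuclideanSpace ℝ (Fin n)

/-- The unit sphere `𝕊ⁿ⁻¹` of `ℝⁿ`; its surface measure is `volume.toSphere`. -/
abbrev USphere (n : ℕ) : Type := sphere (0 : Euc n) 1

/-- The ball `B_R` of radius `R` centred at the origin. -/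
def oball (n : ℕ) (R : ℝ) : Opens (Euc n) := ⟨ball 0 R, isOpen_ball⟩

/-- The partial derivative `∂ᵢ φ` of a differentiable function. -/
def pderiv {n : ℕ} (i : Fin n) (φ : Euc n → ℝ) (x : Euc n) : ℝ :=
  fderiv ℝ φ x (EuclideanSpace.single i 1)

/-- `G` is the weak gradient of the scalar function `u` on the open set `Ω`. -/
structure HasWeakGrad {n : ℕ} (Ω : Opens (Euc n)) (u : Euc n → ℝ) (G : Euc n → Euc n) : Prop where
  locInt : LocallyIntegrableOn u (Ω : Set (Euc n)) volume
  locInt_grad : LocallyIntegrableOn G (Ω : Set (Euc n)) volume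
  integral_eq : ∀ (φ : 𝓓(Ω, ℝ)) (i : Fin n),
    ∫ x in (Ω : Set (Euc n)), u x * pderiv i φ x = -∫ x in (Ω : Set (Euc n)), G x i * φ x

/-- The scalar Sobolev space `W^{1,q}(Ω)`. -/
def MemW1 {n : ℕ} (Ω : Opens (Euc n)) (q : ℝ≥0∞) (u : Euc n → ℝ) : Prop :=
  MemLp u q (volume.restrict (Ω : Set (Euc n))) ∧
    ∃ G : Euc n → Euc n, MemLp G q (volume.restrict (Ω : Set (Euc n))) ∧ HasWeakGrad Ω u G

/-- The tangential divergence `tr DX(σ) - ⟨DX(σ) σ, σ⟩` at a point `σ` of the unit sphere, that is,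
the trace of `DX(σ)` over the tangent space `σ^⊥`. For a field `X` that is tangent to the sphere it
is the Riemannian divergence on the sphere of the restriction of `X`. -/
def sphereDiv {n : ℕ} (X : Euc n → Euc n) (σ : Euc n) : ℝ :=
  (∑ i, (fderiv ℝ X σ (EuclideanSpace.single i 1)) i) - ⟪fderiv ℝ X σ σ, σ⟫

/-- `G` is the weak (Riemannian) gradient of `ξ` on the unit sphere: it is a tangent field, and the
divergence theorem holds against all smooth tangent fields. (Every smooth tangent field of the
sphere is the restriction of a smooth field on `ℝⁿ`.) -/
structure HasWeakSphereGrad {n : ℕ} (ξ : USphere n → ℝ) (G : USphere n → Euc n) : Prop where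
  integrable : Integrable ξ (volume : Measure (Euc n)).toSphere
  integrable_grad : Integrable G (volume : Measure (Euc n)).toSphere
  tangent : ∀ᵐ σ ∂(volume : Measure (Euc n)).toSphere, ⟪G σ, (σ : Euc n)⟫ = 0
  integral_eq : ∀ X : Euc n → Euc n, ContDiff ℝ ∞ X → (∀ σ : USphere n, ⟪X σ, (σ : Euc n)⟫ = 0) →
    ∫ σ, ξ σ * sphereDiv X σ ∂(volume : Measure (Euc n)).toSphere =
      -∫ σ, ⟪G σ, X σ⟫ ∂(volume : Measure (Euc n)).toSphere

/-- The scalar Sobolev space `W^{1,q}(𝕊ⁿ⁻¹)`. -/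
def MemW1Sphere {n : ℕ} (q : ℝ≥0∞) (ξ : USphere n → ℝ) : Prop :=
  MemLp ξ q (volume : Measure (Euc n)).toSphere ∧
    ∃ G : USphere n → Euc n, MemLp G q (volume : Measure (Euc n)).toSphere ∧ HasWeakSphereGrad ξ G

/-- The point `x / |x|` of the unit sphere. -/
def direction {n : ℕ} (x : Euc n) (hx : x ≠ 0) : USphere n :=
  ⟨‖x‖⁻¹ • x, by simp [norm_smul, hx]⟩

/-- The space `𝓗(R)` of vector fields `h ∈ W^{1,2}(B_R)` with `h(x) = |x|⁻¹ ζ(x/|x|)` for almost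
every `x ∈ B_R`, for some vector-valued `ζ ∈ W^{1,2}(𝕊ⁿ⁻¹)`. -/
def MemH {n : ℕ} (R : ℝ) (h : Euc n → Euc n) : Prop :=
  (∀ i, MemW1 (oball n R) 2 (fun x => h x i)) ∧
    ∃ ζ : USphere n → Euc n, (∀ i, MemW1Sphere 2 (fun σ => ζ σ i)) ∧
      ∀ᵐ x ∂volume.restrict (oball n R : Set (Euc n)), ∀ hx : x ≠ 0,
        h x = ‖x‖⁻¹ • ζ (direction x hx)

/-- `div h = 0` on `Ω` in the sense of distributions. -/
def DivFree {n : ℕ} (Ω : Opens (Euc n)) (h : Euc n → Euc n) : Prop :=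
  ∀ φ : 𝓓(Ω, ℝ), ∫ x in (Ω : Set (Euc n)), ∑ i, h x i * pderiv i φ x = 0

/-- `(h · ∇) h + ∇ p = 0` on `Ω` in the sense of distributions. Here `Dh i` is the weak gradient of
the component `h i`, so that `∑ j, h j * Dh i j` is the `i`-th component of `(h · ∇) h`. -/
def EulerMomentum {n : ℕ} (Ω : Opens (Euc n)) (h : Euc n → Euc n) (p : Euc n → ℝ) : Prop :=
  ∃ Dh : Fin n → Euc n → Euc n, (∀ i, HasWeakGrad Ω (fun x => h x i) (Dh i)) ∧
    ∀ (φ : 𝓓(Ω, ℝ)) (i : Fin n),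
      (∫ x in (Ω : Set (Euc n)), (∑ j, h x j * Dh i x j) * φ x) -
        ∫ x in (Ω : Set (Euc n)), p x * pderiv i φ x = 0

end

noncomputable section

/-! The field `h` is homogeneous of degree -1, so its weak gradient is homogeneous of degree -2 and
the convection term f = (h·∇)h of degree -3. Since ∇p = -f, for each 0 < c < 1 the function c²p(cx)
- p(x) has zero weak gradient on the ball and is a constant C(c). Composing the dilations by c and d
in either order gives C(c) + c²C(d) = C(d) + d²C(c), hence C(c) = K(1 - c²) for one number K. Thus p
+ K is homogeneous of degree -2 up to null sets (`exists_ae_homogeneous_add_const`), and a Fubini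
argument produces a profile ξ on the sphere (`exists_sphere_profile`).

The exponent 5/4 comes from Sobolev embedding in dimension 5 (`memLp_of_weakPDeriv_ball`): p + K is
in W^{1,1}, hence locally in L^{5/4}; h is locally in L^{10/3} and its gradient is in L², so f is
locally in L^{5/4} by Hölder. A homogeneous function in L^q of a small ball has its profile in L^q
of the sphere (`memLp_profile`).

The weak gradient of ξ is the tangential part of the profile of -f. It is found by testing ∇p = -f
against the radial extension χ(|x|²)X(x/|x|) of a tangent field X: in polar coordinates both sides
split off the same nonzero radial integral (`integral_mul_sphereDiv_eq`). -/

open Filter Topology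
open scoped NNReal Convolution

/-! ### Calculus of weak partial derivatives -/

/-- `g` is the `i`-th weak partial derivative of `u` on `U`, tested against smooth functions on the
whole space whose support is a compact subset of `U`. -/
def WeakPDeriv {n : ℕ} (U : Set (Euc n)) (i : Fin n) (u g : Euc n → ℝ) : Prop :=
  ∀ φ : Euc n → ℝ, ContDiff ℝ ∞ φ → HasCompactSupport φ → tsupport φ ⊆ U →
    ∫ x, u x * pderiv i φ x = -∫ x, g x * φ x

theorem pderiv_eq_zero_of_notMem_tsupport {n : ℕ} {φ : Euc n → ℝ} {x : Euc n}
    (hx : x ∉ tsupport φ) (i : Fin n) : pderiv i φ x = 0 := by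
  have h : fderiv ℝ φ x = 0 := by
    by_contra h
    exact hx (support_fderiv_subset ℝ (Function.mem_support.2 h))
  simp [pderiv, h]

theorem continuous_pderiv {n : ℕ} {φ : Euc n → ℝ} (hφ : ContDiff ℝ ∞ φ) (i : Fin n) :
    Continuous (pderiv i φ) :=
  (hφ.continuous_fderiv (by simp)).clm_apply continuous_const

theorem hasCompactSupport_pderiv {n : ℕ} {φ : Euc n → ℝ} (hφ : HasCompactSupport φ) (i : Fin n) :
    HasCompactSupport (pderiv i φ) :=
  HasCompactSupport.intro hφ fun _ hx => pderiv_eq_zero_of_notMem_tsupport hx i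

theorem setIntegral_mul_eq_of_tsupport_subset {n : ℕ} {U : Set (Euc n)} {φ u : Euc n → ℝ}
    (hU : tsupport φ ⊆ U) : ∫ x in U, u x * φ x = ∫ x, u x * φ x :=
  setIntegral_eq_integral_of_forall_compl_eq_zero fun x hx => by
    rw [image_eq_zero_of_notMem_tsupport (fun h => hx (hU h)), mul_zero]

theorem setIntegral_mul_pderiv_eq {n : ℕ} {U : Set (Euc n)} {φ u : Euc n → ℝ}
    (hU : tsupport φ ⊆ U) (i : Fin n) :
    ∫ x in U, u x * pderiv i φ x = ∫ x, u x * pderiv i φ x :=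
  setIntegral_eq_integral_of_forall_compl_eq_zero fun x hx => by
    rw [pderiv_eq_zero_of_notMem_tsupport (fun h => hx (hU h)), mul_zero]

/-- A bundled test function from an unbundled one. -/
def mkTest {n : ℕ} (Ω : Opens (Euc n)) (φ : Euc n → ℝ) (h1 : ContDiff ℝ ∞ φ)
    (h2 : HasCompactSupport φ) (h3 : tsupport φ ⊆ Ω) : 𝓓(Ω, ℝ) := ⟨φ, h1, h2, h3⟩

theorem HasWeakGrad.weakPDeriv {n : ℕ} {Ω : Opens (Euc n)} {u : Euc n → ℝ} {G : Euc n → Euc n}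
    (h : HasWeakGrad Ω u G) (i : Fin n) : WeakPDeriv Ω i u (fun x => G x i) := by
  intro φ h1 h2 h3
  have := h.integral_eq (mkTest Ω φ h1 h2 h3) i
  change ∫ x in (Ω : Set (Euc n)), u x * pderiv i φ x = -∫ x in (Ω : Set (Euc n)), G x i * φ x at this
  rwa [setIntegral_mul_pderiv_eq h3, setIntegral_mul_eq_of_tsupport_subset h3] at this

theorem integrable_mul_of_integrableOn {n : ℕ} {U : Set (Euc n)} {u φ : Euc n → ℝ}
    (hu : IntegrableOn u U) (hφ : Continuous φ) (hc : HasCompactSupport φ)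
    (hU : ∀ x ∉ U, φ x = 0) : Integrable (fun x => u x * φ x) := by
  obtain ⟨C, hC⟩ := hφ.bounded_above_of_compact_support hc
  have h1 : IntegrableOn (fun x => u x * φ x) U :=
    Integrable.mul_bdd hu hφ.aestronglyMeasurable (Eventually.of_forall hC)
  exact (integrableOn_iff_integrable_of_support_subset fun x hx => by
    by_contra h
    exact hx (by simp [hU x h])).1 h1

theorem WeakPDeriv.congr_ae {n : ℕ} {U : Set (Euc n)} {i : Fin n}
    {u g u' g' : Euc n → ℝ} (h : WeakPDeriv U i u g)
    (hu : u =ᵐ[volume.restrict U] u') (hg : g =ᵐ[volume.restrict U] g') :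
    WeakPDeriv U i u' g' := by
  intro φ h1 h2 h3
  have := h φ h1 h2 h3
  rw [← setIntegral_mul_pderiv_eq h3, ← setIntegral_mul_eq_of_tsupport_subset h3] at this ⊢
  have e1 : ∫ x in U, u' x * pderiv i φ x = ∫ x in U, u x * pderiv i φ x :=
    integral_congr_ae (hu.mono fun x hx => by simp only [hx])
  have e2 : ∫ x in U, g' x * φ x = ∫ x in U, g x * φ x :=
    integral_congr_ae (hg.mono fun x hx => by simp only [hx])
  rw [e1, e2, this]

/-- The difference of the two candidates integrates to zero against every test function, so the
fundamental lemma of the calculus of variations applies. -/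
theorem WeakPDeriv.unique {n : ℕ} {U : Set (Euc n)} (hU : IsOpen U) {i : Fin n}
    {u g g' : Euc n → ℝ} (h : WeakPDeriv U i u g) (h' : WeakPDeriv U i u g')
    (hg : LocallyIntegrableOn g U) (hg' : LocallyIntegrableOn g' U) :
    g =ᵐ[volume.restrict U] g' := by
  have key : ∀ᵐ x, x ∈ U → (g - g') x = 0 := by
    refine hU.ae_eq_zero_of_integral_contDiff_smul_eq_zero (hg.sub hg') fun φ h1 h2 h3 => ?_
    have e := (h φ h1 h2 h3).symm.trans (h' φ h1 h2 h3)
    have i1 : Integrable (fun x => g x * φ x) := by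
      have := (hg.integrableOn_compact_subset h3 h2.isCompact)
      exact integrable_mul_of_integrableOn this h1.continuous h2
        fun x hx => image_eq_zero_of_notMem_tsupport hx
    have i2 : Integrable (fun x => g' x * φ x) := by
      have := (hg'.integrableOn_compact_subset h3 h2.isCompact)
      exact integrable_mul_of_integrableOn this h1.continuous h2
        fun x hx => image_eq_zero_of_notMem_tsupport hx
    have : ∫ x, φ x • (g - g') x = (∫ x, g x * φ x) - ∫ x, g' x * φ x := by
      rw [← integral_sub i1 i2]
      congr 1 with x
      simp [mul_sub, mul_comm]
    rw [this]; linarith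
  rw [EventuallyEq, ae_restrict_iff' hU.measurableSet]
  filter_upwards [key] with x hx hxU
  exact sub_eq_zero.1 (hx hxU)

theorem WeakPDeriv.sub {n : ℕ} {U : Set (Euc n)} {i : Fin n}
    {u g u' g' : Euc n → ℝ} (h : WeakPDeriv U i u g) (h' : WeakPDeriv U i u' g')
    (hu : IntegrableOn u U) (hu' : IntegrableOn u' U) (hg : IntegrableOn g U)
    (hg' : IntegrableOn g' U) :
    WeakPDeriv U i (fun x => u x - u' x) (fun x => g x - g' x) := by
  intro φ h1 h2 h3
  have z1 : ∀ x ∉ U, φ x = 0 := fun x hx => image_eq_zero_of_notMem_tsupport fun h => hx (h3 h)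
  have z2 : ∀ x ∉ U, pderiv i φ x = 0 :=
    fun x hx => pderiv_eq_zero_of_notMem_tsupport (fun h => hx (h3 h)) i
  have c1 := continuous_pderiv h1 i
  have c2 := hasCompactSupport_pderiv h2 i
  simp only [sub_mul]
  rw [integral_sub (integrable_mul_of_integrableOn hu c1 c2 z2)
      (integrable_mul_of_integrableOn hu' c1 c2 z2),
    integral_sub (integrable_mul_of_integrableOn hg h1.continuous h2 z1)
      (integrable_mul_of_integrableOn hg' h1.continuous h2 z1), h φ h1 h2 h3, h' φ h1 h2 h3]
  ring

theorem WeakPDeriv.const_mul {n : ℕ} {U : Set (Euc n)} {i : Fin n}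
    {u g : Euc n → ℝ} (h : WeakPDeriv U i u g) (c : ℝ) :
    WeakPDeriv U i (fun x => c * u x) (fun x => c * g x) := by
  intro φ h1 h2 h3
  simp only [mul_assoc, integral_const_mul, h φ h1 h2 h3, mul_neg]

theorem weakPDeriv_const {n : ℕ} {U : Set (Euc n)} (i : Fin n) (c : ℝ) :
    WeakPDeriv U i (fun _ => c) (fun _ => 0) := by
  intro φ h1 h2 _
  have : ∫ x, pderiv i φ x = 0 := by
    have h3 : Integrable (fun x => (1 : ℝ) * pderiv i φ x) := by
      simpa using (continuous_pderiv h1 i).integrable_of_hasCompactSupport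
        (hasCompactSupport_pderiv h2 i)
    have h4 : Integrable (fun x => (1 : ℝ) * φ x) := by
      simpa using h1.continuous.integrable_of_hasCompactSupport h2
    have := integral_mul_fderiv_eq_neg_fderiv_mul_of_integrable (μ := (volume : Measure (Euc n)))
      (f := fun _ : Euc n => (1 : ℝ)) (g := φ) (v := EuclideanSpace.single i 1)
      (by simp) h3 h4 (fun _ _ => by fun_prop) (fun x _ => h1.differentiable (by simp) x)
    simpa [pderiv] using this
  change ∫ x, c * pderiv i φ x = -∫ x, 0 * φ x
  simp [integral_const_mul, this]

theorem pderiv_comp_smul {n : ℕ} {φ : Euc n → ℝ} (hφ : ContDiff ℝ ∞ φ) (i : Fin n) (c : ℝ)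
    (x : Euc n) : pderiv i (fun y => φ (c • y)) x = c * pderiv i φ (c • x) := by
  have h1 : HasFDerivAt φ (fderiv ℝ φ (c • x)) (c • x) :=
    (hφ.differentiable (by simp) _).hasFDerivAt
  have h2 : HasFDerivAt (fun y : Euc n => c • y) (c • ContinuousLinearMap.id ℝ (Euc n)) x :=
    (hasFDerivAt_id x).const_smul c
  have h3 := h1.comp x h2
  have h4 : fderiv ℝ (fun y => φ (c • y)) x = _ := h3.fderiv
  rw [pderiv, h4]
  simp [pderiv]

theorem WeakPDeriv.comp_smul {n : ℕ} {i : Fin n} {u g : Euc n → ℝ} {R : ℝ}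
    (h : WeakPDeriv (ball 0 R) i u g) {c : ℝ} (hc : 0 < c) (hc1 : c ≤ 1) :
    WeakPDeriv (ball 0 R) i (fun x => u (c • x)) (fun x => c * g (c • x)) := by
  intro φ h1 h2 h3
  have hc0 : c ≠ 0 := hc.ne'
  -- The test function is dilated the other way and the variable is changed on both sides; the
  -- Jacobians agree. Its support is c times that of `φ`, which stays in the ball because c ≤ 1.
  set ψ : Euc n → ℝ := fun y => φ (c⁻¹ • y) with hψ
  have e1 : ContDiff ℝ ∞ ψ := h1.comp (contDiff_const_smul _)
  have e2 : HasCompactSupport ψ := h2.comp_smul (inv_ne_zero hc0)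
  have e3 : tsupport ψ ⊆ ball 0 R := by
    intro y hy
    have : c⁻¹ • y ∈ tsupport φ := tsupport_comp_subset_preimage φ (continuous_const_smul c⁻¹) hy
    have := h3 this
    simp only [mem_ball_zero_iff, norm_smul, norm_inv, Real.norm_eq_abs, abs_of_pos hc] at this ⊢
    rw [inv_mul_lt_iff₀ hc] at this
    have hR : 0 < R := by
      by_contra hR
      nlinarith [norm_nonneg y]
    nlinarith
  have e := h ψ e1 e2 e3
  have l1 := Measure.integral_comp_smul (volume : Measure (Euc n)) (fun y => u y * pderiv i ψ y) c
  have l2 := Measure.integral_comp_smul (volume : Measure (Euc n)) (fun y => g y * ψ y) c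
  have p1 : ∀ x, pderiv i ψ (c • x) = c⁻¹ * pderiv i φ x := fun x => by
    rw [hψ, pderiv_comp_smul h1, inv_smul_smul₀ hc0]
  simp only [p1] at l1
  simp only [hψ, inv_smul_smul₀ hc0] at l2
  have q1 : ∫ x, u (c • x) * pderiv i φ x = c * ∫ x, u (c • x) * (c⁻¹ * pderiv i φ x) := by
    rw [← integral_const_mul]
    congr 1 with x
    field_simp
  have q2 : ∫ x, c * g (c • x) * φ x = c * ∫ x, g (c • x) * φ x := by
    rw [← integral_const_mul]
    congr 1 with x
    ring
  rw [q1, q2, l1, l2, e]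
  simp [hψ]

/-! ### Mollification and functions with zero weak gradient -/

/-- The convolution of `u` with the kernel `ρ`. -/
def mollify {n : ℕ} (ρ u : Euc n → ℝ) (x : Euc n) : ℝ := ∫ t, u t * ρ (x - t)

theorem mollify_eq_convolution {n : ℕ} (ρ u : Euc n → ℝ) :
    mollify ρ u = (u ⋆[ContinuousLinearMap.lsmul ℝ ℝ, volume] ρ) := rfl

theorem mollify_eq_convolution_swap {n : ℕ} (ρ u : Euc n → ℝ) :
    mollify ρ u = (ρ ⋆[ContinuousLinearMap.lsmul ℝ ℝ, volume] u) := by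
  ext x
  rw [convolution_lsmul_swap]
  simp [mollify, mul_comm]

theorem contDiff_mollify {n : ℕ} {ρ u : Euc n → ℝ} (hρ : ContDiff ℝ ∞ ρ)
    (hc : HasCompactSupport ρ) (hu : LocallyIntegrable u) : ContDiff ℝ ∞ (mollify ρ u) :=
  hc.contDiff_convolution_right (ContinuousLinearMap.lsmul ℝ ℝ) hu hρ

theorem pderiv_mollify {n : ℕ} {ρ u : Euc n → ℝ} (hρ : ContDiff ℝ ∞ ρ)
    (hc : HasCompactSupport ρ) (hu : LocallyIntegrable u) (i : Fin n) (x : Euc n) :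
    pderiv i (mollify ρ u) x = ∫ t, u t * pderiv i ρ (x - t) := by
  have h := hc.hasFDerivAt_convolution_right (ContinuousLinearMap.lsmul ℝ ℝ) hu
    (hρ.of_le (by simp)) x
  rw [pderiv, mollify_eq_convolution, h.fderiv, convolution_precompR_apply]
  · rfl
  · exact hu
  · exact hc.fderiv ℝ
  · exact hρ.continuous_fderiv (by simp)

theorem pderiv_comp_sub {n : ℕ} {ρ : Euc n → ℝ} (hρ : ContDiff ℝ ∞ ρ) (i : Fin n) (x t : Euc n) :
    pderiv i (fun s => ρ (x - s)) t = -pderiv i ρ (x - t) := by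
  have h1 : HasFDerivAt ρ (fderiv ℝ ρ (x - t)) (x - t) :=
    (hρ.differentiable (by simp) _).hasFDerivAt
  have h2 : HasFDerivAt (fun s : Euc n => x - s) (-ContinuousLinearMap.id ℝ (Euc n)) t :=
    (hasFDerivAt_id t).const_sub x
  have h4 : fderiv ℝ (fun s => ρ (x - s)) t = _ := (h1.comp t h2).fderiv
  rw [pderiv, h4]
  simp [pderiv]

theorem tsupport_comp_sub_subset {n : ℕ} {ρ : Euc n → ℝ} {r : ℝ}
    (hr : tsupport ρ ⊆ closedBall 0 r) (x : Euc n) :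
    tsupport (fun s => ρ (x - s)) ⊆ closedBall x r := by
  intro s hs
  have := hr (tsupport_comp_subset_preimage ρ (f := fun s => x - s) (by fun_prop) hs)
  simpa [dist_eq_norm, norm_sub_rev] using this

/-- When the closed r-ball about x lies in U, t ↦ ρ(x - t) is an admissible test function. Its
derivative in t carries a minus sign, which cancels the one in the weak formulation. -/
theorem WeakPDeriv.pderiv_mollify {n : ℕ} {U : Set (Euc n)} {i : Fin n} {ρ u g : Euc n → ℝ}
    (h : WeakPDeriv U i u g) (hρ : ContDiff ℝ ∞ ρ) (hu : LocallyIntegrable u) {r : ℝ}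
    (hr : tsupport ρ ⊆ closedBall 0 r) {x : Euc n} (hx : closedBall x r ⊆ U) :
    pderiv i (mollify ρ u) x = mollify ρ g x := by
  have hc : HasCompactSupport ρ :=
    HasCompactSupport.of_support_subset_isCompact (isCompact_closedBall _ _)
      ((subset_tsupport ρ).trans hr)
  have h3 := tsupport_comp_sub_subset hr x
  have := h (fun s => ρ (x - s)) (hρ.comp (contDiff_const.sub contDiff_id))
    (HasCompactSupport.of_support_subset_isCompact (isCompact_closedBall _ _)
      ((subset_tsupport _).trans h3)) (h3.trans hx)
  simp only [pderiv_comp_sub hρ, mul_neg, integral_neg, neg_inj] at this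
  rw [_root_.pderiv_mollify hρ hc hu, this, mollify]

/-- A sequence of bump functions at the origin with radii tending to zero. -/
def shrinkingBump (n : ℕ) (k : ℕ) : ContDiffBump (0 : Euc n) where
  rIn := 1 / (k + 1 : ℝ)
  rOut := 2 * (1 / (k + 1 : ℝ))
  rIn_pos := by positivity
  rIn_lt_rOut := by
    have : (0 : ℝ) < 1 / (k + 1 : ℝ) := by positivity
    linarith

/-- The standard mollifiers. -/
def mollifier (n : ℕ) (k : ℕ) : Euc n → ℝ := (shrinkingBump n k).normed volume

theorem tendsto_shrinkingBump_rOut (n : ℕ) :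
    Tendsto (fun k => (shrinkingBump n k).rOut) atTop (𝓝 0) := by
  have := (tendsto_one_div_add_atTop_nhds_zero_nat (𝕜 := ℝ)).const_mul 2
  simpa [shrinkingBump] using this

theorem contDiff_mollifier (n k : ℕ) : ContDiff ℝ ∞ (mollifier n k) :=
  (shrinkingBump n k).contDiff_normed

theorem tsupport_mollifier (n k : ℕ) :
    tsupport (mollifier n k) ⊆ closedBall 0 (shrinkingBump n k).rOut :=
  ((shrinkingBump n k).tsupport_normed_eq (μ := volume)).subset

theorem hasCompactSupport_mollifier (n k : ℕ) : HasCompactSupport (mollifier n k) :=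
  (shrinkingBump n k).hasCompactSupport_normed

theorem ae_tendsto_mollify {n : ℕ} {u : Euc n → ℝ} (hu : LocallyIntegrable u) :
    ∀ᵐ x, Tendsto (fun k => mollify (mollifier n k) u x) atTop (𝓝 (u x)) := by
  simp_rw [mollify_eq_convolution_swap]
  exact ContDiffBump.ae_convolution_tendsto_right_of_locallyIntegrable (K := 2)
    (tendsto_shrinkingBump_rOut n) (Eventually.of_forall fun k => le_rfl) hu

theorem fderiv_eq_zero_of_pderiv {n : ℕ} {v : Euc n → ℝ} {x : Euc n}
    (h : ∀ i, pderiv i v x = 0) : fderiv ℝ v x = 0 := by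
  have : (fderiv ℝ v x : Euc n →ₗ[ℝ] ℝ) = 0 :=
    (EuclideanSpace.basisFun (Fin n) ℝ).toBasis.ext fun i => by simpa [pderiv] using h i
  ext y
  exact congrArg (fun L => L y) this

/-- A function on a ball whose weak gradient vanishes is almost everywhere constant. -/
theorem exists_ae_eq_const_of_weakPDeriv_zero {n : ℕ} {R : ℝ} {u : Euc n → ℝ}
    (hu : IntegrableOn u (ball 0 R))
    (h : ∀ i, WeakPDeriv (ball 0 R) i u (fun _ => 0)) :
    ∃ c : ℝ, ∀ᵐ x ∂volume.restrict (ball 0 R), u x = c := by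
  set w : Euc n → ℝ := (ball 0 R).indicator u with hw
  have hwi : LocallyIntegrable w := (hu.integrable_indicator measurableSet_ball).locallyIntegrable
  have huw : ∀ᵐ x ∂volume.restrict (ball 0 R), u x = w x := by
    filter_upwards [ae_restrict_mem measurableSet_ball] with x hx
    rw [hw, Set.indicator_of_mem hx]
  have hwd : ∀ i, WeakPDeriv (ball 0 R) i w (fun _ => 0) := fun i =>
    (h i).congr_ae huw EventuallyEq.rfl
  have key : ∀ x ∈ ball (0 : Euc n) R, ∀ y ∈ ball (0 : Euc n) R,
      ∀ᶠ k in atTop, mollify (mollifier n k) w x = mollify (mollifier n k) w y := by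
    intro x hx y hy
    have hx' : ‖x‖ < R := by simpa using hx
    have hy' : ‖y‖ < R := by simpa using hy
    -- Once the bump radius is below this gap, the mollification has zero gradient on the closed
    -- ball through the outer of the two points, which is convex and contains both.
    have hm : 0 < R - max ‖x‖ ‖y‖ := by simp [hx', hy']
    filter_upwards [(tendsto_shrinkingBump_rOut n).eventually (gt_mem_nhds hm)] with k hk
    set S := closedBall (0 : Euc n) (max ‖x‖ ‖y‖)
    have hd : ∀ z ∈ S, fderiv ℝ (mollify (mollifier n k) w) z = 0 := by
      intro z hz
      refine fderiv_eq_zero_of_pderiv fun i => ?_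
      rw [(hwd i).pderiv_mollify (contDiff_mollifier n k) hwi (tsupport_mollifier n k)]
      · simp [mollify]
      · refine closedBall_subset_ball' ?_
        have : dist z 0 ≤ max ‖x‖ ‖y‖ := hz
        linarith
    have hdiff := (contDiff_mollify (contDiff_mollifier n k) (hasCompactSupport_mollifier n k)
      hwi).differentiable (by simp)
    refine (convex_closedBall (0 : Euc n) (max ‖x‖ ‖y‖)).is_const_of_fderivWithin_eq_zero (𝕜 := ℝ)
      hdiff.differentiableOn ?_ (by simp) (by simp)
    intro z hz
    have h0 : HasFDerivWithinAt (mollify (mollifier n k) w) (0 : Euc n →L[ℝ] ℝ) S z :=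
      hd z hz ▸ (hdiff z).hasFDerivAt.hasFDerivWithinAt
    -- By definition `fderivWithin` is 0 as soon as 0 is a derivative within the set, so no
    -- uniqueness of derivatives on S is needed.
    rw [fderivWithin, if_pos h0]
  have hconv := ae_restrict_of_ae (s := ball (0 : Euc n) R) (ae_tendsto_mollify hwi)
  by_cases hne : (volume.restrict (ball (0 : Euc n) R)) = 0
  · exact ⟨0, by simp [hne]⟩
  have : (ae (volume.restrict (ball (0 : Euc n) R))).NeBot := ae_neBot.2 hne
  obtain ⟨y, hy, hyB⟩ := (hconv.and (ae_restrict_mem measurableSet_ball)).exists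
  refine ⟨w y, ?_⟩
  filter_upwards [hconv, huw, ae_restrict_mem measurableSet_ball] with x hx hux hxB
  rw [hux]
  exact tendsto_nhds_unique (hx.congr' (key x hxB y hyB)) hy

/-! ### Sobolev embedding for weak derivatives -/

/-- Jensen's inequality for averages with respect to a probability measure. -/
theorem lintegral_enorm_rpow_le {α : Type*} [MeasurableSpace α] {ν : Measure α}
    [IsProbabilityMeasure ν] {f : α → ℝ} (hf : AEStronglyMeasurable f ν) {p : ℝ} (hp : 1 ≤ p) :
    (∫⁻ a, ‖f a‖ₑ ∂ν) ^ p ≤ ∫⁻ a, ‖f a‖ₑ ^ p ∂ν := by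
  have h := eLpNorm'_le_eLpNorm'_of_exponent_le (μ := ν) zero_lt_one hp hf
  have h2 := ENNReal.rpow_le_rpow h (zero_le_one.trans hp)
  simp only [eLpNorm', ENNReal.rpow_one, div_one] at h2
  rwa [← ENNReal.rpow_mul, one_div, inv_mul_cancel₀ (by linarith), ENNReal.rpow_one] at h2

/-- Averaging against a probability density does not increase `Lᵖ` norms. -/
theorem eLpNorm_mollify_le {n : ℕ} {ρ g : Euc n → ℝ} (hρ : Continuous ρ) (h0 : ∀ x, 0 ≤ ρ x)
    (hc : HasCompactSupport ρ)
    (h1 : ∫ x, ρ x = 1) (hg : AEStronglyMeasurable g volume) {p : ℝ≥0} (hp : 1 ≤ p) :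
    eLpNorm (mollify ρ g) p volume ≤ eLpNorm g p volume := by
  -- Mollification sees only the almost everywhere class of g; a genuinely measurable representative
  -- makes Tonelli available below.
  wlog hgm : StronglyMeasurable g generalizing g
  · have e : mollify ρ g = mollify ρ (hg.mk g) := by
      ext x
      exact integral_congr_ae (hg.ae_eq_mk.mono fun t ht => by simp only [ht])
    rw [e, eLpNorm_congr_ae hg.ae_eq_mk]
    exact this hg.stronglyMeasurable_mk.aestronglyMeasurable hg.stronglyMeasurable_mk
  have hp0 : (0 : ℝ) < p := lt_of_lt_of_le zero_lt_one (by exact_mod_cast hp)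
  have hp0' : p ≠ 0 := by exact_mod_cast hp0.ne'
  set d : Euc n → ℝ≥0∞ := fun s => ENNReal.ofReal (ρ s) with hd
  have hdm : Measurable d := hρ.measurable.ennreal_ofReal
  set ν := (volume : Measure (Euc n)).withDensity d with hν
  have hνp : IsProbabilityMeasure ν := by
    constructor
    rw [hν, withDensity_apply _ MeasurableSet.univ, Measure.restrict_univ, hd,
      ← ofReal_integral_eq_lintegral_ofReal (hρ.integrable_of_hasCompactSupport hc)
        (Eventually.of_forall h0), h1, ENNReal.ofReal_one]
  have hpt : ∀ x, ‖mollify ρ g x‖ₑ ^ (p : ℝ) ≤ ∫⁻ s, d s * ‖g (x - s)‖ₑ ^ (p : ℝ) := by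
    intro x
    have e : ‖mollify ρ g x‖ₑ ≤ ∫⁻ s, ‖g (x - s)‖ₑ ∂ν := by
      rw [mollify_eq_convolution_swap, convolution_def]
      refine (enorm_integral_le_lintegral_enorm _).trans_eq ?_
      rw [hν, lintegral_withDensity_eq_lintegral_mul _ hdm]
      · congr 1 with s
        simp [hd, enorm_mul, Real.enorm_of_nonneg (h0 s)]
      · exact (hgm.measurable.comp (measurable_const.sub measurable_id)).enorm
    refine (ENNReal.rpow_le_rpow e hp0.le).trans ?_
    refine (lintegral_enorm_rpow_le ?_ (by exact_mod_cast hp)).trans_eq ?_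
    · exact (hgm.measurable.comp (measurable_const.sub measurable_id)).aestronglyMeasurable
    · rw [hν, lintegral_withDensity_eq_lintegral_mul _ hdm]
      · rfl
      · exact (hgm.measurable.comp (measurable_const.sub measurable_id)).enorm.pow_const _
  rw [eLpNorm_nnreal_eq_lintegral hp0', eLpNorm_nnreal_eq_lintegral hp0']
  refine ENNReal.rpow_le_rpow ?_ (by positivity)
  refine (lintegral_mono hpt).trans ?_
  rw [lintegral_lintegral_swap]
  · have : ∀ s, ∫⁻ x, d s * ‖g (x - s)‖ₑ ^ (p : ℝ) = d s * ∫⁻ x, ‖g x‖ₑ ^ (p : ℝ) := by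
      intro s
      rw [lintegral_const_mul, lintegral_sub_right_eq_self (fun x => ‖g x‖ₑ ^ (p : ℝ)) s]
      exact (hgm.measurable.comp (measurable_id.sub measurable_const)).enorm.pow_const _
    simp_rw [this]
    rw [lintegral_mul_const _ hdm, hd,
      ← ofReal_integral_eq_lintegral_ofReal (hρ.integrable_of_hasCompactSupport hc)
        (Eventually.of_forall h0), h1, ENNReal.ofReal_one, one_mul]
  · exact ((hdm.comp measurable_snd).mul
      ((hgm.measurable.comp (measurable_fst.sub measurable_snd)).enorm.pow_const _)).aemeasurable

theorem norm_fderiv_le_sum_pderiv {n : ℕ} (v : Euc n → ℝ) (x : Euc n) :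
    ‖fderiv ℝ v x‖ ≤ ∑ i, ‖pderiv i v x‖ := by
  refine ContinuousLinearMap.opNorm_le_bound _ (Finset.sum_nonneg fun _ _ => norm_nonneg _)
    fun y => ?_
  have hy : y = ∑ i, y i • EuclideanSpace.single i (1 : ℝ) := by
    simpa using ((EuclideanSpace.basisFun (Fin n) ℝ).sum_repr y).symm
  conv_lhs => rw [hy]
  rw [map_sum, Finset.sum_mul]
  refine norm_sum_le_of_le _ fun i _ => ?_
  rw [map_smul, norm_smul, mul_comm]
  exact mul_le_mul_of_nonneg_left (PiLp.norm_apply_le y i) (norm_nonneg _)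

/-- The Gagliardo–Nirenberg–Sobolev inequality for compactly supported functions with weak
derivatives in `Lᵖ`. -/
theorem memLp_of_weakPDeriv_univ {n : ℕ} (hn : 0 < n) {u : Euc n → ℝ} {g : Fin n → Euc n → ℝ}
    {p p' : ℝ≥0} (hp : 1 ≤ p) (hp' : (p' : ℝ)⁻¹ = (p : ℝ)⁻¹ - (n : ℝ)⁻¹)
    (hu : Integrable u) (hc : HasCompactSupport u) (hg : ∀ i, MemLp (g i) p volume)
    (hw : ∀ i, WeakPDeriv Set.univ i u (g i)) : MemLp u p' volume := by
  refine ⟨hu.1, ?_⟩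
  have hul := hu.locallyIntegrable
  set C := eLpNormLESNormFDerivOfEqInnerConst (volume : Measure (Euc n)) p
  -- The smooth inequality applies to each mollification, whose derivatives are the mollified g i;
  -- the resulting bound does not depend on k and passes to u by Fatou.
  have bound : ∀ k, eLpNorm (mollify (mollifier n k) u) p' volume ≤
      C * ∑ i, eLpNorm (g i) p volume := by
    intro k
    have hρ := contDiff_mollifier n k
    have hρc := hasCompactSupport_mollifier n k
    have hsm := contDiff_mollify hρ hρc hul
    have hcs : HasCompactSupport (mollify (mollifier n k) u) := by
      rw [mollify_eq_convolution]
      exact HasCompactSupport.convolution _ hc hρc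
    refine (eLpNorm_le_eLpNorm_fderiv_of_eq_inner volume (hsm.of_le (by simp)) hcs hp
      (by simpa using hn) (by simpa using hp')).trans ?_
    refine mul_le_mul_right ?_ _
    have hgk : ∀ i, pderiv i (mollify (mollifier n k) u) = mollify (mollifier n k) (g i) :=
      fun i => funext fun x => (hw i).pderiv_mollify hρ hul (tsupport_mollifier n k)
        (Set.subset_univ _)
    have hmeas : ∀ i, AEStronglyMeasurable (fun x => ‖mollify (mollifier n k) (g i) x‖) volume :=
      fun i => by
        rw [← hgk i]
        exact (continuous_pderiv hsm i).norm.aestronglyMeasurable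
    calc eLpNorm (fderiv ℝ (mollify (mollifier n k) u)) p volume
        ≤ eLpNorm (∑ i, fun x => ‖mollify (mollifier n k) (g i) x‖) p volume := by
          refine eLpNorm_mono_real fun x => ?_
          refine (norm_fderiv_le_sum_pderiv _ x).trans_eq ?_
          simp [Finset.sum_apply, hgk]
      _ ≤ ∑ i, eLpNorm (fun x => ‖mollify (mollifier n k) (g i) x‖) p volume :=
          eLpNorm_sum_le (fun i _ => hmeas i) (by exact_mod_cast hp)
      _ ≤ ∑ i, eLpNorm (g i) p volume := by
          refine Finset.sum_le_sum fun i _ => ?_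
          rw [eLpNorm_norm]
          exact eLpNorm_mollify_le hρ.continuous (fun x => (shrinkingBump n k).nonneg_normed x)
            hρc (shrinkingBump n k).integral_normed (hg i).1 hp
  have hlim := Lp.eLpNorm_lim_le_liminf_eLpNorm (p := (p' : ℝ≥0∞)) (fun k => (contDiff_mollify
    (contDiff_mollifier n k) (hasCompactSupport_mollifier n k)
    hul).continuous.aestronglyMeasurable) u (ae_tendsto_mollify hul)
  refine hlim.trans_lt (lt_of_le_of_lt (b := C * ∑ i, eLpNorm (g i) p volume) ?_ ?_)
  · exact (liminf_le_liminf (Eventually.of_forall bound)).trans_eq (by simp)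
  · exact ENNReal.mul_lt_top (by simp) (ENNReal.sum_lt_top.2 fun i _ => (hg i).2)

theorem pderiv_mul {n : ℕ} {χ φ : Euc n → ℝ} (hχ : ContDiff ℝ ∞ χ) (hφ : ContDiff ℝ ∞ φ)
    (i : Fin n) (x : Euc n) :
    pderiv i (fun y => χ y * φ y) x = χ x * pderiv i φ x + φ x * pderiv i χ x := by
  have h : fderiv ℝ (fun y => χ y * φ y) x = _ :=
    ((hχ.differentiable (by simp) x).hasFDerivAt.mul
      (hφ.differentiable (by simp) x).hasFDerivAt).fderiv
  rw [pderiv, h]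
  simp [pderiv]

/-- The product rule for a smooth cut-off function. -/
theorem WeakPDeriv.cutoff {n : ℕ} {U : Set (Euc n)} {i : Fin n} {u g χ : Euc n → ℝ}
    (h : WeakPDeriv U i u g) (hu : IntegrableOn u U) (hg : IntegrableOn g U)
    (hχ : ContDiff ℝ ∞ χ) (hc : HasCompactSupport χ) (hs : tsupport χ ⊆ U) :
    WeakPDeriv Set.univ i (fun x => u x * χ x) (fun x => g x * χ x + u x * pderiv i χ x) := by
  intro φ h1 h2 _
  have hsub : tsupport (fun y => χ y * φ y) ⊆ tsupport χ := tsupport_mul_subset_left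
  have e := h (fun y => χ y * φ y) (hχ.mul h1) (hc.mul_right) (hsub.trans hs)
  simp only [pderiv_mul hχ h1, mul_add] at e
  have z1 : ∀ x ∉ U, χ x = 0 := fun x hx => image_eq_zero_of_notMem_tsupport fun h => hx (hs h)
  have z2 : ∀ x ∉ U, pderiv i χ x = 0 :=
    fun x hx => pderiv_eq_zero_of_notMem_tsupport (fun h => hx (hs h)) i
  have c1 := continuous_pderiv h1 i
  have c2 := continuous_pderiv hχ i
  have i1 : Integrable fun x => u x * (χ x * pderiv i φ x) :=
    integrable_mul_of_integrableOn hu (hχ.continuous.mul c1) hc.mul_right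
      fun x hx => by simp [z1 x hx]
  have i2 : Integrable fun x => u x * (φ x * pderiv i χ x) :=
    integrable_mul_of_integrableOn hu (h1.continuous.mul c2) h2.mul_right
      fun x hx => by simp [z2 x hx]
  have i3 : Integrable fun x => g x * (χ x * φ x) :=
    integrable_mul_of_integrableOn hg (hχ.continuous.mul h1.continuous) hc.mul_right
      fun x hx => by simp [z1 x hx]
  rw [integral_add i1 i2] at e
  have q1 : ∫ x, u x * χ x * pderiv i φ x = ∫ x, u x * (χ x * pderiv i φ x) := by
    congr 1 with x; ring
  have q2 : ∫ x, (g x * χ x + u x * pderiv i χ x) * φ x =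
      (∫ x, g x * (χ x * φ x)) + ∫ x, u x * (φ x * pderiv i χ x) := by
    rw [← integral_add i3 i2]
    congr 1 with x; ring
  rw [q1, q2]
  linarith

theorem memLp_mul_of_memLp_restrict {n : ℕ} {U : Set (Euc n)} {u φ : Euc n → ℝ} {p : ℝ≥0∞}
    (hU : MeasurableSet U) (hu : MemLp u p (volume.restrict U)) (hφ : Continuous φ)
    (hc : HasCompactSupport φ) (hz : ∀ x ∉ U, φ x = 0) : MemLp (fun x => u x * φ x) p volume := by
  obtain ⟨C, hC⟩ := hφ.bounded_above_of_compact_support hc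
  have h1 : MemLp (fun x => u x * φ x) p (volume.restrict U) :=
    (MemLp.of_le_mul (c := C) hu (hu.1.mul hφ.aestronglyMeasurable)
      (Eventually.of_forall fun x => by
        rw [norm_mul, mul_comm]
        exact mul_le_mul_of_nonneg_right (hC x) (norm_nonneg _)))
  rw [← memLp_indicator_iff_restrict hU] at h1
  have e : (fun x => u x * φ x) = U.indicator fun x => u x * φ x := by
    funext x
    by_cases hx : x ∈ U <;> simp [hx, hz]
  rwa [e]

/-- Local Sobolev embedding on balls. -/
theorem memLp_of_weakPDeriv_ball {n : ℕ} (hn : 0 < n) {u : Euc n → ℝ} {g : Fin n → Euc n → ℝ}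
    {p p' : ℝ≥0} (hp : 1 ≤ p) (hp' : (p' : ℝ)⁻¹ = (p : ℝ)⁻¹ - (n : ℝ)⁻¹) {r R : ℝ} (hr : 0 < r)
    (hrR : r < R) (hu : MemLp u p (volume.restrict (ball 0 R)))
    (hg : ∀ i, MemLp (g i) p (volume.restrict (ball 0 R)))
    (hw : ∀ i, WeakPDeriv (ball 0 R) i u (g i)) : MemLp u p' (volume.restrict (ball 0 r)) := by
  have hp1 : (1 : ℝ≥0∞) ≤ p := by exact_mod_cast hp
  let b : ContDiffBump (0 : Euc n) := ⟨r, (r + R) / 2, hr, by linarith⟩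
  have hb : ContDiff ℝ ∞ b := b.contDiff
  have hbs : tsupport b ⊆ ball 0 R := by
    rw [b.tsupport_eq]
    exact closedBall_subset_ball (by change (r + R) / 2 < R; linarith)
  have hbz : ∀ x ∉ ball (0 : Euc n) R, b x = 0 :=
    fun x hx => image_eq_zero_of_notMem_tsupport fun h => hx (hbs h)
  have : IsFiniteMeasure (volume.restrict (ball (0 : Euc n) R)) :=
    isFiniteMeasure_restrict.2 measure_ball_lt_top.ne
  have hui : IntegrableOn u (ball 0 R) := hu.integrable hp1
  have hgi : ∀ i, IntegrableOn (g i) (ball 0 R) := fun i => (hg i).integrable hp1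
  have key : MemLp (fun x => u x * b x) p' volume :=
    memLp_of_weakPDeriv_univ hn hp hp'
      (integrable_mul_of_integrableOn hui hb.continuous b.hasCompactSupport hbz)
      b.hasCompactSupport.mul_left
      (fun i => (memLp_mul_of_memLp_restrict measurableSet_ball (hg i) hb.continuous
        b.hasCompactSupport hbz).add (memLp_mul_of_memLp_restrict measurableSet_ball hu
          (continuous_pderiv hb i) (hasCompactSupport_pderiv b.hasCompactSupport i)
          fun x hx => pderiv_eq_zero_of_notMem_tsupport (fun h => hx (hbs h)) i))
      fun i => (hw i).cutoff hui (hgi i) hb b.hasCompactSupport hbs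
  refine (memLp_congr_ae ?_).1 (key.restrict (ball 0 r))
  filter_upwards [ae_restrict_mem measurableSet_ball] with x hx
  rw [b.one_of_mem_closedBall (ball_subset_closedBall hx), mul_one]

/-! ### Polar coordinates -/

/-- The radial part `r ^ (n - 1) dr` of Lebesgue measure in polar coordinates. -/
abbrev radialMeasure (n : ℕ) : Measure (Set.Ioi (0 : ℝ)) :=
  Measure.volumeIoiPow (Module.finrank ℝ (Euc n) - 1)

/-- The surface measure of the unit sphere. -/
abbrev sphereMeasure (n : ℕ) : Measure (USphere n) := (volume : Measure (Euc n)).toSphere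

/-- Polar coordinates `(σ, r) ↦ r σ`. -/
def polar {n : ℕ} (z : USphere n × Set.Ioi (0 : ℝ)) : Euc n := (z.2 : ℝ) • (z.1 : Euc n)

theorem norm_polar {n : ℕ} (z : USphere n × Set.Ioi (0 : ℝ)) : ‖polar z‖ = z.2 := by
  have := z.2.2
  simp only [Set.mem_Ioi] at this
  simp [polar, norm_smul, abs_of_pos this]

theorem polar_ne_zero {n : ℕ} (z : USphere n × Set.Ioi (0 : ℝ)) : polar z ≠ 0 := by
  rw [← norm_ne_zero_iff, norm_polar]
  exact z.2.2.ne'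

theorem direction_polar {n : ℕ} (z : USphere n × Set.Ioi (0 : ℝ)) :
    direction (polar z) (polar_ne_zero z) = z.1 := by
  apply Subtype.ext
  simp only [direction, norm_polar]
  rw [polar, inv_smul_smul₀ z.2.2.ne']

theorem polar_eq {n : ℕ} : (polar : USphere n × Set.Ioi (0 : ℝ) → Euc n) =
    Subtype.val ∘ (homeomorphUnitSphereProd (Euc n)).symm := rfl

theorem measurableEmbedding_polar {n : ℕ} :
    MeasurableEmbedding (polar : USphere n × Set.Ioi (0 : ℝ) → Euc n) := by
  rw [polar_eq]
  exact (MeasurableEmbedding.subtype_coe (measurableSet_singleton _).compl).comp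
    (Homeomorph.measurableEmbedding _)

/-- `polar` inverts the standard homeomorphism of the punctured space, and the origin is a null set
since the dimension is positive. -/
theorem measurePreserving_polar {n : ℕ} [NeZero n] :
    MeasurePreserving (polar : USphere n × Set.Ioi (0 : ℝ) → Euc n)
      ((sphereMeasure n).prod (radialMeasure n)) volume := by
  have h1 := (volume : Measure (Euc n)).measurePreserving_homeomorphUnitSphereProd
  have h2 : MeasurePreserving (homeomorphUnitSphereProd (Euc n)).symm
      ((sphereMeasure n).prod (radialMeasure n))
      ((volume : Measure (Euc n)).comap (Subtype.val : ({0}ᶜ : Set (Euc n)) → Euc n)) :=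
    MeasurePreserving.symm (homeomorphUnitSphereProd (Euc n)).toMeasurableEquiv h1
  have h3 := (measurePreserving_subtype_coe (μa := (volume : Measure (Euc n)))
    (measurableSet_singleton (0 : Euc n)).compl)
  have h4 : (volume : Measure (Euc n)).restrict {0}ᶜ = volume :=
    Measure.restrict_eq_self_of_ae_mem (by simp [ae_iff])
  rw [h4] at h3
  exact h3.comp h2

theorem ae_polar_iff {n : ℕ} [NeZero n] {Q : Euc n → Prop} :
    (∀ᵐ x, Q x) ↔ ∀ᵐ z ∂(sphereMeasure n).prod (radialMeasure n), Q (polar z) := by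
  rw [← measurePreserving_polar.map_eq, measurableEmbedding_polar.ae_map_iff]

/-- No integrability is required: the product formula for Bochner integrals holds unconditionally.
-/
theorem integral_eq_radial_mul_sphere {n : ℕ} [NeZero n] {g : Euc n → ℝ} {a : ℝ → ℝ}
    {b : USphere n → ℝ} (h : ∀ᵐ x, ∀ hx : x ≠ 0, g x = a ‖x‖ * b (direction x hx)) :
    ∫ x, g x = (∫ r, a r ∂radialMeasure n) * ∫ σ, b σ ∂sphereMeasure n := by
  rw [← measurePreserving_polar.integral_comp measurableEmbedding_polar, mul_comm,
    ← integral_prod_mul]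
  refine integral_congr_ae ?_
  filter_upwards [ae_polar_iff.1 h] with z hz
  rw [hz (polar_ne_zero z), direction_polar, norm_polar, mul_comm]

/-! ### Homogeneity up to null sets and profiles on the sphere -/

theorem ae_ball_comp_smul {n : ℕ} {R : ℝ} {Q : Euc n → Prop}
    (h : ∀ᵐ x ∂volume.restrict (ball 0 R), Q x) {c : ℝ} (hc : 0 < c) (hc1 : c ≤ 1) :
    ∀ᵐ x ∂volume.restrict (ball 0 R), Q (c • x) := by
  rw [ae_restrict_iff' measurableSet_ball] at h ⊢
  have hq : Measure.QuasiMeasurePreserving (fun x : Euc n => c • x) volume volume := by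
    refine ⟨measurable_const_smul c, ?_⟩
    rw [Measure.map_addHaar_smul _ hc.ne']
    exact Measure.smul_absolutelyContinuous
  filter_upwards [hq.ae h] with x hx hxR
  refine hx ?_
  simp only [mem_ball_zero_iff, norm_smul, Real.norm_eq_abs, abs_of_pos hc] at hxR ⊢
  nlinarith [norm_nonneg x]

theorem ae_Ioo_of_ae_scaled {Q : ℝ → Prop} {r : ℝ} (hr : 0 < r)
    (h : ∀ᵐ l ∂volume.restrict (Set.Ioo (0 : ℝ) 1), Q (l * r)) :
    ∀ᵐ s ∂volume.restrict (Set.Ioo (0 : ℝ) r), Q s := by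
  rw [ae_restrict_iff' measurableSet_Ioo] at h ⊢
  have hq : Measure.QuasiMeasurePreserving (fun x : ℝ => r⁻¹ • x) volume volume := by
    refine ⟨measurable_const_smul _, ?_⟩
    rw [Measure.map_addHaar_smul _ (inv_ne_zero hr.ne')]
    exact Measure.smul_absolutelyContinuous
  filter_upwards [hq.ae h] with s hs hsr
  have e : r⁻¹ • s * r = s := by simp [smul_eq_mul]; field_simp
  rw [← e]
  refine hs ⟨by have := hsr.1; simp only [smul_eq_mul]; positivity, ?_⟩
  rw [smul_eq_mul, inv_mul_lt_iff₀ hr]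
  simpa using hsr.2

/-- A function on the positive half-line that is almost everywhere invariant under contractions is
almost everywhere equal on `(0, 1)` to its average there. -/
theorem ae_eq_setAverage_of_scale_invariant {n : ℕ} {g : ℝ → ℝ}
    (h : ∀ᵐ r : Set.Ioi (0 : ℝ) ∂radialMeasure n, (r : ℝ) < 1 →
      ∀ᵐ l ∂volume.restrict (Set.Ioo (0 : ℝ) 1), g (l * r) = g r) :
    ∀ᵐ r : Set.Ioi (0 : ℝ) ∂radialMeasure n, (r : ℝ) < 1 →
      g r = ⨍ s in {s : Set.Ioi (0 : ℝ) | (s : ℝ) < 1}, g s ∂radialMeasure n := by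
  set A : Set (Set.Ioi (0 : ℝ)) := {s | (s : ℝ) < 1} with hA
  have hAI : A = Set.Iio (⟨1, Set.mem_Ioi.2 one_pos⟩ : Set.Ioi (0 : ℝ)) := by
    ext s; simp [hA, ← Subtype.coe_lt_coe]
  have hAm : MeasurableSet A := hAI ▸ measurableSet_Iio
  have hA0 : radialMeasure n A ≠ 0 := by
    rw [hAI, Measure.volumeIoiPow_apply_Iio]
    simp only [one_pow, ne_eq, ENNReal.ofReal_eq_zero, not_le]
    positivity
  have hAt : radialMeasure n A ≠ ⊤ := by
    rw [hAI, Measure.volumeIoiPow_apply_Iio]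
    exact ENNReal.ofReal_ne_top
  -- The contractions of r and r' sweep out (0, r) and (0, r'); on the overlap g takes both values
  -- almost everywhere, so the values agree.
  have hpair : ∀ r r' : ℝ, 0 < r → 0 < r' →
      (∀ᵐ l ∂volume.restrict (Set.Ioo (0 : ℝ) 1), g (l * r) = g r) →
      (∀ᵐ l ∂volume.restrict (Set.Ioo (0 : ℝ) 1), g (l * r') = g r') → g r = g r' := by
    intro r r' hr hr' e e'
    have a1 := ae_Ioo_of_ae_scaled (Q := fun s => g s = g r) hr e
    have a2 := ae_Ioo_of_ae_scaled (Q := fun s => g s = g r') hr' e'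
    have b1 := ae_restrict_of_ae_restrict_of_subset
      (Set.Ioo_subset_Ioo_right (min_le_left r r')) a1
    have b2 := ae_restrict_of_ae_restrict_of_subset
      (Set.Ioo_subset_Ioo_right (min_le_right r r')) a2
    have : (ae (volume.restrict (Set.Ioo (0 : ℝ) (min r r')))).NeBot := by
      rw [ae_neBot, Ne, Measure.restrict_eq_zero]
      simp [hr, hr']
    obtain ⟨s, h1, h2⟩ := (b1.and b2).exists
    exact h1.symm.trans h2
  replace h := (ae_restrict_iff' (p := fun r : Set.Ioi (0 : ℝ) =>
    ∀ᵐ l ∂volume.restrict (Set.Ioo (0 : ℝ) 1), g (l * r) = g r) hAm).2 h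
  have : (ae ((radialMeasure n).restrict A)).NeBot := by
    rwa [ae_neBot, Ne, Measure.restrict_eq_zero]
  obtain ⟨r₀, hr₀⟩ := h.exists
  have hconst : ∀ᵐ r : Set.Ioi (0 : ℝ) ∂(radialMeasure n).restrict A, g r = g r₀ := by
    filter_upwards [h] with r hr using hpair r r₀ r.2 r₀.2 hr hr₀
  have havg : ⨍ s in A, g s ∂radialMeasure n = g r₀ := by
    rw [average_congr hconst]
    have : IsFiniteMeasure ((radialMeasure n).restrict A) := isFiniteMeasure_restrict.2 hAt
    have : NeZero ((radialMeasure n).restrict A) := ⟨by rwa [Ne, Measure.restrict_eq_zero]⟩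
    exact average_const _ _
  change ∀ᵐ r ∂radialMeasure n, r ∈ A → _
  rw [← ae_restrict_iff' hAm]
  filter_upwards [hconst] with r hr
  rw [hr, havg]

/-- A measurable function on the unit ball that is homogeneous of degree `-k` up to null sets is
almost everywhere given by a function of the direction. -/
theorem exists_sphere_profile {n : ℕ} [NeZero n] {u : Euc n → ℝ} {k : ℕ}
    (hu : AEStronglyMeasurable u (volume.restrict (ball 0 1)))
    (h : ∀ c : ℝ, 0 < c → c < 1 →
      ∀ᵐ x ∂volume.restrict (ball 0 1), c ^ k * u (c • x) = u x) :
    ∃ v : USphere n → ℝ, StronglyMeasurable v ∧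
      ∀ᵐ x ∂volume.restrict (ball 0 1), ∀ hx : x ≠ 0, u x = v (direction x hx) / ‖x‖ ^ k := by
  -- A measurable representative defined everywhere is needed to restrict to rays and to exchange
  -- quantifiers by Fubini.
  set w := hu.mk u with hw
  have hwm : Measurable w := hu.stronglyMeasurable_mk.measurable
  have huw : ∀ᵐ x ∂volume.restrict (ball 0 1), u x = w x := hu.ae_eq_mk
  have hh : ∀ c : ℝ, 0 < c → c < 1 → ∀ᵐ x : Euc n, ‖x‖ < 1 → c ^ k * w (c • x) = w x := by
    intro c hc hc1
    have e : ∀ᵐ x ∂volume.restrict (ball (0 : Euc n) 1), c ^ k * w (c • x) = w x := by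
      filter_upwards [h c hc hc1, huw, ae_ball_comp_smul huw hc hc1.le] with x a1 a2 a3
      rw [← a2, ← a3, a1]
    rw [ae_restrict_iff' measurableSet_ball] at e
    simpa using e
  set U : USphere n → ℝ → ℝ := fun σ r => r ^ k * w (r • (σ : Euc n)) with hU
  have hUm : Measurable (Function.uncurry U) := by
    refine (measurable_snd.pow_const k).mul (hwm.comp ?_)
    exact measurable_snd.smul (measurable_subtype_coe.comp measurable_fst)
  have s1 : ∀ᵐ l ∂volume.restrict (Set.Ioo (0 : ℝ) 1),
      ∀ᵐ z ∂(sphereMeasure n).prod (radialMeasure n),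
        (z.2 : ℝ) < 1 → U z.1 (l * z.2) = U z.1 z.2 := by
    filter_upwards [ae_restrict_mem measurableSet_Ioo] with l hl
    filter_upwards [ae_polar_iff.1 (hh l hl.1 hl.2)] with z hz hz1
    have := hz (by rwa [norm_polar])
    simp only [polar, smul_smul] at this
    simp only [hU, mul_pow]
    rw [← this]
    ring
  have hmeas : MeasurableSet {q : ℝ × (USphere n × Set.Ioi (0 : ℝ)) |
      (q.2.2 : ℝ) < 1 → U q.2.1 (q.1 * q.2.2) = U q.2.1 q.2.2} := by
    refine MeasurableSet.imp (measurableSet_lt (by fun_prop) measurable_const)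
      (measurableSet_eq_fun ?_ ?_)
    · exact hUm.comp (f := fun q : ℝ × (USphere n × Set.Ioi (0 : ℝ)) =>
        (q.2.1, q.1 * (q.2.2 : ℝ))) (by fun_prop)
    · exact hUm.comp (f := fun q : ℝ × (USphere n × Set.Ioi (0 : ℝ)) =>
        (q.2.1, (q.2.2 : ℝ))) (by fun_prop)
  -- The exceptional null set in the hypothesis depends on the dilation factor. Fubini reverses the
  -- order, so that on almost every ray the invariance holds for almost every factor.
  have s2 := (Measure.ae_ae_comm hmeas).1 s1
  have s3 := Measure.ae_ae_of_ae_prod s2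
  have s4 : ∀ᵐ σ ∂sphereMeasure n, ∀ᵐ r : Set.Ioi (0 : ℝ) ∂radialMeasure n, (r : ℝ) < 1 →
      U σ r = ⨍ s in {s : Set.Ioi (0 : ℝ) | (s : ℝ) < 1}, U σ s ∂radialMeasure n := by
    filter_upwards [s3] with σ hσ
    refine ae_eq_setAverage_of_scale_invariant ?_
    filter_upwards [hσ] with r hr hr1
    filter_upwards [hr] with l hl using hl hr1
  -- On almost every ray `U σ` is constant for r < 1. Taking its average, rather than choosing a
  -- value, makes the profile measurable in σ.
  set v : USphere n → ℝ := fun σ =>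
    ⨍ s in {s : Set.Ioi (0 : ℝ) | (s : ℝ) < 1}, U σ s ∂radialMeasure n with hv
  have hUm' : StronglyMeasurable
      (fun q : USphere n × Set.Ioi (0 : ℝ) => U q.1 q.2) :=
    (hUm.comp (f := fun q : USphere n × Set.Ioi (0 : ℝ) => (q.1, (q.2 : ℝ)))
      (by fun_prop)).stronglyMeasurable
  have hvm : StronglyMeasurable v := by
    have := hUm'.integral_prod_right'
      (ν := (radialMeasure n).restrict {s : Set.Ioi (0 : ℝ) | (s : ℝ) < 1})
    simp only [hv, setAverage_eq]
    exact this.const_smul (_ : ℝ)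
  refine ⟨v, hvm, ?_⟩
  have hmeas2 : MeasurableSet {q : USphere n × Set.Ioi (0 : ℝ) |
      (q.2 : ℝ) < 1 → U q.1 q.2 = v q.1} :=
    MeasurableSet.imp (measurableSet_lt (by fun_prop) measurable_const)
      (measurableSet_eq_fun hUm'.measurable (hvm.measurable.comp measurable_fst))
  have s5 := (Measure.ae_prod_iff_ae_ae hmeas2).2 s4
  have s6 : ∀ᵐ x : Euc n, ‖x‖ < 1 → ∀ hx : x ≠ 0, w x = v (direction x hx) / ‖x‖ ^ k := by
    rw [ae_polar_iff]
    filter_upwards [s5] with z hz hz1 hx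
    rw [norm_polar] at hz1
    rw [direction_polar, norm_polar, ← hz hz1]
    have : (z.2 : ℝ) ≠ 0 := z.2.2.ne'
    simp only [hU, polar]
    field_simp
  have s7 : ∀ᵐ x ∂volume.restrict (ball (0 : Euc n) 1), ∀ hx : x ≠ 0,
      w x = v (direction x hx) / ‖x‖ ^ k := by
    rw [ae_restrict_iff' measurableSet_ball]
    simpa using s6
  filter_upwards [s7, huw] with x h1 h2 hx
  rw [h2, h1 hx]

/-- In polar coordinates |u|^q is integrable on a product, so almost every spherical slice is
integrable; one slice of radius s gives v up to the factor s^k. -/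
theorem memLp_profile {n : ℕ} [NeZero n] {u : Euc n → ℝ} {v : USphere n → ℝ} {k : ℕ}
    {q : ℝ≥0∞} (hq0 : q ≠ 0) (hqt : q ≠ ⊤) {r : ℝ} (hr : 0 < r)
    (hu : MemLp u q (volume.restrict (ball 0 r))) (hv : StronglyMeasurable v)
    (h : ∀ᵐ x ∂volume.restrict (ball 0 r), ∀ hx : x ≠ 0, u x = v (direction x hx) / ‖x‖ ^ k) :
    MemLp v q (sphereMeasure n) := by
  set A : Set (Set.Ioi (0 : ℝ)) := Set.Iio ⟨r, hr⟩ with hA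
  have hpre : (polar : USphere n × Set.Ioi (0 : ℝ) → Euc n) ⁻¹' (ball 0 r) = Set.univ ×ˢ A := by
    ext z
    simp [norm_polar, hA, ← Subtype.coe_lt_coe]
  have hmp : MeasurePreserving (polar : USphere n × Set.Ioi (0 : ℝ) → Euc n)
      ((sphereMeasure n).prod ((radialMeasure n).restrict A)) (volume.restrict (ball 0 r)) := by
    have := measurePreserving_polar (n := n).restrict_preimage (measurableSet_ball (x := 0) (ε := r))
    rwa [hpre, ← Measure.prod_restrict, Measure.restrict_univ] at this
  have h1 : MemLp (fun z : USphere n × Set.Ioi (0 : ℝ) => v z.1 / (z.2 : ℝ) ^ k) q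
      ((sphereMeasure n).prod ((radialMeasure n).restrict A)) := by
    refine (memLp_congr_ae ?_).1 (hu.comp_measurePreserving hmp)
    filter_upwards [hmp.quasiMeasurePreserving.ae h] with z hz
    rw [Function.comp_apply, hz (polar_ne_zero z), direction_polar, norm_polar]
  have h2 := ((h1.integrable_norm_rpow hq0 hqt).prod_left_ae)
  have : (ae ((radialMeasure n).restrict A)).NeBot := by
    rw [ae_neBot, Ne, Measure.restrict_eq_zero, Measure.volumeIoiPow_apply_Iio]
    simp only [ENNReal.ofReal_eq_zero, not_le]
    positivity
  obtain ⟨s, hs⟩ := h2.exists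
  have hm : AEStronglyMeasurable (fun σ => v σ / (s : ℝ) ^ k) (sphereMeasure n) := by
    simp only [div_eq_mul_inv]
    exact (hv.mul_const _).aestronglyMeasurable
  have h3 := ((integrable_norm_rpow_iff hm hq0 hqt).1 hs).mul_const ((s : ℝ) ^ k)
  have hs0 : (s : ℝ) ^ k ≠ 0 := pow_ne_zero _ s.2.ne'
  simpa [div_mul_cancel₀ _ hs0] using h3

theorem integrableOn_ball_comp_smul {n : ℕ} {R : ℝ} {u : Euc n → ℝ} (hu : IntegrableOn u (ball 0 R))
    {c : ℝ} (hc : 0 < c) (hc1 : c ≤ 1) : IntegrableOn (fun x => u (c • x)) (ball 0 R) := by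
  have h1 := (hu.integrable_indicator measurableSet_ball).comp_smul hc.ne'
  refine (integrableOn_congr_fun (fun x hx => ?_) measurableSet_ball).1 h1.integrableOn
  refine Set.indicator_of_mem ?_ _
  simp only [mem_ball_zero_iff, norm_smul, Real.norm_eq_abs, abs_of_pos hc] at hx ⊢
  nlinarith [norm_nonneg x]

/-- Weak derivatives of functions that are homogeneous of degree `-k` on the unit ball are
homogeneous of degree `-(k + 1)`. -/
theorem WeakPDeriv.ae_homogeneous {n : ℕ} {i : Fin n} {u g : Euc n → ℝ} {k : ℕ}
    (h : WeakPDeriv (ball 0 1) i u g) (hg : IntegrableOn g (ball 0 1)) {c : ℝ} (hc : 0 < c)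
    (hc1 : c < 1) (hu : ∀ᵐ x ∂volume.restrict (ball 0 1), c ^ k * u (c • x) = u x) :
    ∀ᵐ x ∂volume.restrict (ball 0 1), c ^ (k + 1) * g (c • x) = g x := by
  have h1 := ((h.comp_smul hc hc1.le).const_mul (c ^ k)).congr_ae hu EventuallyEq.rfl
  have h2 : IntegrableOn (fun x => c ^ k * (c * g (c • x))) (ball 0 1) :=
    ((integrableOn_ball_comp_smul hg hc hc1.le).const_mul c).const_mul (c ^ k)
  filter_upwards [h1.unique isOpen_ball h h2.locallyIntegrableOn hg.locallyIntegrableOn] with x hx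
  rw [← hx]
  ring

/-- If the gradient of `p` is homogeneous of degree `-3`, then `p` is homogeneous of degree `-2` up
to an additive constant. -/
theorem exists_ae_homogeneous_add_const {n : ℕ} {p : Euc n → ℝ} {g : Fin n → Euc n → ℝ}
    (hp : IntegrableOn p (ball 0 1)) (hg : ∀ i, IntegrableOn (g i) (ball 0 1))
    (hw : ∀ i, WeakPDeriv (ball 0 1) i p (g i))
    (hh : ∀ i, ∀ c : ℝ, 0 < c → c < 1 →
      ∀ᵐ x ∂volume.restrict (ball 0 1), c ^ 3 * g i (c • x) = g i x) :
    ∃ K : ℝ, ∀ c : ℝ, 0 < c → c < 1 →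
      ∀ᵐ x ∂volume.restrict (ball 0 1), c ^ 2 * (p (c • x) + K) = p x + K := by
  rcases eq_or_ne (volume.restrict (ball (0 : Euc n) 1)) 0 with h0 | h0
  · exact ⟨0, fun c _ _ => by simp [h0]⟩
  have hne : (ae (volume.restrict (ball (0 : Euc n) 1))).NeBot := ae_neBot.2 h0
  -- The weak gradient of c²p(cx) - p(x) is c³g(cx) - g(x), which vanishes.
  have key : ∀ c : ℝ, 0 < c → c < 1 →
      ∃ C : ℝ, ∀ᵐ x ∂volume.restrict (ball 0 1), c ^ 2 * p (c • x) - p x = C := by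
    intro c hc hc1
    refine exists_ae_eq_const_of_weakPDeriv_zero
      (((integrableOn_ball_comp_smul hp hc hc1.le).const_mul (c ^ 2)).sub hp) fun i => ?_
    have h1 := ((hw i).comp_smul hc hc1.le).const_mul (c ^ 2)
    refine (h1.sub (hw i) ((integrableOn_ball_comp_smul hp hc hc1.le).const_mul (c ^ 2)) hp
      (((integrableOn_ball_comp_smul (hg i) hc hc1.le).const_mul c).const_mul (c ^ 2))
      (hg i)).congr_ae EventuallyEq.rfl ?_
    filter_upwards [hh i c hc hc1] with x hx
    rw [← hx]
    ring
  choose! C hC using key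
  -- Both sides equal c²d²p(cdx) - p(x), reached through p(cx) or through p(dx).
  have comm : ∀ c d : ℝ, 0 < c → c < 1 → 0 < d → d < 1 →
      C c + c ^ 2 * C d = C d + d ^ 2 * C c := by
    intro c d hc hc1 hd hd1
    obtain ⟨x, a1, a2, a3, a4⟩ := ((hC c hc hc1).and ((hC d hd hd1).and
      ((ae_ball_comp_smul (hC c hc hc1) hd hd1.le).and
        (ae_ball_comp_smul (hC d hd hd1) hc hc1.le)))).exists
    rw [smul_smul] at a3 a4
    rw [mul_comm d c] at a4
    linear_combination d ^ 2 * a3 + a2 - c ^ 2 * a4 - a1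
  -- Taking d = 1/2 in `comm` gives (3/4)C(c) = (1 - c²)C(1/2), and K must satisfy C(c) = (1 - c²)K.
  refine ⟨4 / 3 * C (1 / 2), fun c hc hc1 => ?_⟩
  filter_upwards [hC c hc hc1] with x hx
  have := comm c (1 / 2) hc hc1 (by norm_num) (by norm_num)
  linear_combination hx + 4 / 3 * this

theorem direction_smul {n : ℕ} {x : Euc n} (hx : x ≠ 0) {c : ℝ} (hc : 0 < c) (hcx : c • x ≠ 0) :
    direction (c • x) hcx = direction x hx := by
  apply Subtype.ext
  simp only [direction, norm_smul, Real.norm_eq_abs, abs_of_pos hc, smul_smul, mul_inv]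
  congr 1
  field_simp

theorem MemH.ae_homogeneous {n : ℕ} [NeZero n] {h : Euc n → Euc n} (hh : MemH 1 h) {c : ℝ}
    (hc : 0 < c) (hc1 : c < 1) (i : Fin n) :
    ∀ᵐ x ∂volume.restrict (ball 0 1), c ^ 1 * h (c • x) i = h x i := by
  obtain ⟨-, ζ, -, hζ⟩ := hh
  change ∀ᵐ x ∂volume.restrict (ball 0 1), _ at hζ
  have h0 : ∀ᵐ x ∂volume.restrict (ball (0 : Euc n) 1), x ≠ 0 :=
    ae_restrict_of_ae (by simp [ae_iff])
  filter_upwards [hζ, ae_ball_comp_smul hζ hc hc1.le, h0] with x a1 a2 hx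
  have hcx : c • x ≠ 0 := smul_ne_zero hc.ne' hx
  rw [a1 hx, a2 hcx, direction_smul hx hc]
  simp only [norm_smul, Real.norm_eq_abs, abs_of_pos hc, PiLp.smul_apply, smul_eq_mul]
  field_simp

/-! ### Radial extensions and the weak gradient on the sphere -/

/-- Derivative of the radial projection `x ↦ x / |x|`. -/
theorem hasFDerivAt_radialProjection {n : ℕ} {x : Euc n} (hx : x ≠ 0) :
    ∃ L : Euc n →L[ℝ] Euc n, HasFDerivAt (fun y : Euc n => ‖y‖⁻¹ • y) L x ∧
      ∀ v, L v = ‖x‖⁻¹ • (v - ⟪‖x‖⁻¹ • x, v⟫ • (‖x‖⁻¹ • x)) := by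
  have hx' : ‖x‖ ≠ 0 := norm_ne_zero_iff.2 hx
  have h1 := (hasStrictFDerivAt_norm_sq x).hasFDerivAt.sqrt (pow_ne_zero 2 hx')
  simp only [Real.sqrt_sq (norm_nonneg _)] at h1
  have h2 := (hasDerivAt_inv hx').comp_hasFDerivAt x h1
  have h3 := h2.smul (hasFDerivAt_id x)
  refine ⟨_, h3, fun v => ?_⟩
  simp only [Function.comp_apply, add_apply, smul_apply,
    ContinuousLinearMap.smulRight_apply, ContinuousLinearMap.id_apply, innerSL_apply_apply, id_eq,
    smul_eq_mul, nsmul_eq_mul, real_inner_smul_left, smul_smul, sub_eq_add_neg]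
  rw [← neg_smul]
  simp
  field_simp
  rw [smul_smul]
  congr 1
  field_simp

/-- The radial extension `χ(|x|²) X(x/|x|)` of a field on the sphere. -/
def radialExt {n : ℕ} (χ : ℝ → ℝ) (X : Euc n → Euc n) (i : Fin n) (x : Euc n) : ℝ :=
  χ (‖x‖ ^ 2) * X (‖x‖⁻¹ • x) i

/-- The singularity of x/|x| is harmless because the cut-off vanishes near the origin. -/
theorem contDiff_radialExt {n : ℕ} {χ : ℝ → ℝ} {X : Euc n → Euc n} (hχ : ContDiff ℝ ∞ χ)
    (h0 : ∀ᶠ t in 𝓝 0, χ t = 0) (hX : ContDiff ℝ ∞ X) (i : Fin n) :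
    ContDiff ℝ ∞ (radialExt χ X i) := by
  rw [contDiff_iff_contDiffAt]
  intro x
  rcases eq_or_ne x 0 with rfl | hx
  · have ht : Tendsto (fun x : Euc n => ‖x‖ ^ 2) (𝓝 0) (𝓝 0) := by
      have : Continuous fun x : Euc n => ‖x‖ ^ 2 := by fun_prop
      simpa using this.tendsto 0
    refine (contDiffAt_const (c := (0 : ℝ))).congr_of_eventuallyEq ?_
    filter_upwards [ht.eventually h0] with y hy
    simp [radialExt, hy]
  · have h1 : ContDiffAt ℝ ∞ (fun y : Euc n => ‖y‖⁻¹ • y) x :=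
      ((contDiffAt_norm ℝ hx).inv (norm_ne_zero_iff.2 hx)).smul contDiffAt_id
    have h2 : ContDiffAt ℝ ∞ (fun y : Euc n => X (‖y‖⁻¹ • y)) x :=
      ContDiffAt.comp x (hX.contDiffAt) h1
    have h3 : ContDiffAt ℝ ∞ (fun y : Euc n => χ (‖y‖ ^ 2)) x :=
      (hχ.comp (contDiff_norm_sq ℝ)).contDiffAt
    exact h3.mul ((contDiffAt_euclidean.1 h2) i)

/-- The derivative of the cut-off is radial, so it pairs to zero with the tangent field X. What
remains is the trace of DX composed with the tangential projection, scaled by 1/|x|. -/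
theorem sum_pderiv_radialExt {n : ℕ} {χ : ℝ → ℝ} {X : Euc n → Euc n} (hχ : ContDiff ℝ ∞ χ)
    (hX : ContDiff ℝ ∞ X) (ht : ∀ σ : USphere n, ⟪X σ, (σ : Euc n)⟫ = 0) {x : Euc n} (hx : x ≠ 0) :
    ∑ i, pderiv i (radialExt χ X i) x =
      χ (‖x‖ ^ 2) * ‖x‖⁻¹ * sphereDiv X (direction x hx) := by
  obtain ⟨L, hL, hLv⟩ := hasFDerivAt_radialProjection hx
  set σ : Euc n := ‖x‖⁻¹ • x with hσ
  have hdσ : (direction x hx : Euc n) = σ := rfl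
  have hX1 : HasFDerivAt (fun y : Euc n => X (‖y‖⁻¹ • y)) ((fderiv ℝ X σ).comp L) x :=
    ((hX.differentiable (by simp) σ).hasFDerivAt).comp x hL
  have hχ1 := ((hχ.differentiable (by simp) (‖x‖ ^ 2)).hasDerivAt).comp_hasFDerivAt x
    (hasStrictFDerivAt_norm_sq x).hasFDerivAt
  have hY : ∀ i, pderiv i (radialExt χ X i) x =
      χ (‖x‖ ^ 2) * (‖x‖⁻¹ * ((fderiv ℝ X σ (EuclideanSpace.single i 1)) i -
        σ i * (fderiv ℝ X σ σ) i)) + 2 * deriv χ (‖x‖ ^ 2) * (x i * X σ i) := by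
    intro i
    have hXi : HasFDerivAt (fun y : Euc n => X (‖y‖⁻¹ • y) i)
        ((EuclideanSpace.proj i : Euc n →L[ℝ] ℝ).comp ((fderiv ℝ X σ).comp L)) x :=
      (EuclideanSpace.proj i : Euc n →L[ℝ] ℝ).hasFDerivAt.comp x hX1
    have h := (hχ1.mul hXi).fderiv
    have h' : fderiv ℝ (radialExt χ X i) x = _ := h
    rw [pderiv, h']
    simp [hLv, ← hσ, EuclideanSpace.inner_single_right]
    ring
  have hinner : ∑ i, x i * X σ i = 0 := by
    have h1 := ht (direction x hx)
    rw [hdσ, hσ, real_inner_smul_right, ← hσ] at h1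
    have h2 : ⟪X σ, x⟫ = 0 := by
      simpa [norm_ne_zero_iff.2 hx, hx] using h1
    simpa [PiLp.inner_apply, mul_comm] using h2
  simp_rw [hY]
  rw [Finset.sum_add_distrib, ← Finset.mul_sum, ← Finset.mul_sum, ← Finset.mul_sum, hinner,
    mul_zero, add_zero, Finset.sum_sub_distrib, sphereDiv, hdσ, mul_assoc]
  congr 3

/-- A smooth radial cut-off profile supported in `[1/4, 3/4]`. -/
def annulusBump : ContDiffBump (1 / 2 : ℝ) := ⟨1 / 8, 1 / 4, by norm_num, by norm_num⟩

theorem annulusBump_eq_zero {t : ℝ} (ht : t ≤ 1 / 4 ∨ 3 / 4 ≤ t) : annulusBump t = 0 := by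
  refine annulusBump.zero_of_le_dist ?_
  change 1 / 4 ≤ dist t (1 / 2)
  rw [Real.dist_eq]
  rcases ht with ht | ht
  · rw [abs_of_nonpos (by linarith)]; linarith
  · rw [abs_of_nonneg (by linarith)]; linarith

/-- The cut-off profile `t² b(t)`, where the weight makes `χ(|x|²) / |x|³` continuous. -/
def annulusCutoff (t : ℝ) : ℝ := t ^ 2 * annulusBump t

theorem contDiff_annulusCutoff : ContDiff ℝ ∞ annulusCutoff :=
  (contDiff_id.pow 2).mul annulusBump.contDiff

theorem tsupport_radialExt_annulusCutoff {n : ℕ} (X : Euc n → Euc n) (i : Fin n) :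
    tsupport (radialExt annulusCutoff X i) ⊆ {x | ‖x‖ ^ 2 ≤ 3 / 4} := by
  refine closure_minimal (fun x hx => ?_) (isClosed_le (by fun_prop) continuous_const)
  by_contra h
  simp only [Set.mem_ofPred_eq, not_le] at h
  exact hx (by simp [radialExt, annulusCutoff, annulusBump_eq_zero (Or.inr h.le)])

/-- This is the common radial factor to be cancelled. Multiplied by the area of the sphere it is the
integral over the whole space of |x|b(|x|²), with b = `annulusBump`; that function is continuous,
nonnegative and positive at |x|² = 1/2. -/
theorem radial_integral_ne_zero {n : ℕ} [NeZero n] :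
    ∫ r, annulusCutoff ((r : ℝ) ^ 2) * ((r : ℝ) ^ 3)⁻¹ ∂radialMeasure n ≠ 0 := by
  intro h0
  set ψ : Euc n → ℝ := fun x => ‖x‖ * annulusBump (‖x‖ ^ 2) with hψ
  have e := integral_eq_radial_mul_sphere (n := n) (g := ψ)
    (a := fun r => annulusCutoff (r ^ 2) * (r ^ 3)⁻¹) (b := fun _ => 1)
    (Eventually.of_forall fun x hx => by
      have : ‖x‖ ≠ 0 := norm_ne_zero_iff.2 hx
      simp only [hψ, annulusCutoff, mul_one]
      field_simp)
  rw [h0, zero_mul] at e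
  have hcont : Continuous ψ :=
    continuous_norm.mul (annulusBump.continuous.comp (continuous_norm.pow 2))
  have hcs : HasCompactSupport ψ :=
    HasCompactSupport.intro (isCompact_closedBall (0 : Euc n) 1) fun x hx => by
      have h1 : 1 < ‖x‖ := by simpa using hx
      have : 3 / 4 ≤ ‖x‖ ^ 2 := by nlinarith
      simp [hψ, annulusBump_eq_zero (Or.inr this)]
  have hpos : 0 < ∫ x, ψ x := by
    refine hcont.integral_pos_of_hasCompactSupport_nonneg_nonzero hcs
      (fun x => mul_nonneg (norm_nonneg _) annulusBump.nonneg)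
      (x := √(1 / 2) • EuclideanSpace.single (0 : Fin n) (1 : ℝ)) ?_
    have h1 : ‖√(1 / 2) • EuclideanSpace.single (0 : Fin n) (1 : ℝ)‖ = √(1 / 2) := by
      rw [norm_smul]
      simp
    have h2 : annulusBump (1 / 2) = 1 := annulusBump.one_of_mem_closedBall (by simp [annulusBump])
    simp only [hψ, h1, Real.sq_sqrt (show (0 : ℝ) ≤ 1 / 2 by norm_num), h2, mul_one]
    positivity
  exact hpos.ne' e

/-- Let `P = ξ(x/|x|) / |x|²` have weak gradient `-F(x/|x|) / |x|³` on the unit ball. Then the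
tangential part of `-F` satisfies the divergence theorem for `ξ` on the sphere. -/
theorem integral_mul_sphereDiv_eq {n : ℕ} [NeZero n] {P : Euc n → ℝ} {f : Fin n → Euc n → ℝ}
    {ξ : USphere n → ℝ} {F : Fin n → USphere n → ℝ}
    (hP : IntegrableOn P (ball 0 1)) (hf : ∀ i, IntegrableOn (f i) (ball 0 1))
    (hw : ∀ i, WeakPDeriv (ball 0 1) i P (fun x => -f i x))
    (hξ : ∀ᵐ x ∂volume.restrict (ball 0 1), ∀ hx : x ≠ 0, P x = ξ (direction x hx) / ‖x‖ ^ 2)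
    (hF : ∀ i, ∀ᵐ x ∂volume.restrict (ball 0 1), ∀ hx : x ≠ 0,
      f i x = F i (direction x hx) / ‖x‖ ^ 3)
    {X : Euc n → Euc n} (hX : ContDiff ℝ ∞ X) (ht : ∀ σ : USphere n, ⟪X σ, (σ : Euc n)⟫ = 0) :
    ∫ σ, ξ σ * sphereDiv X σ ∂sphereMeasure n = ∫ σ, ∑ i, F i σ * X σ i ∂sphereMeasure n := by
  set Y := radialExt annulusCutoff X with hYdef
  have hχ0 : ∀ᶠ t in 𝓝 (0 : ℝ), annulusCutoff t = 0 := by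
    filter_upwards [ge_mem_nhds (show (0 : ℝ) < 1 / 4 by norm_num)] with t h
    simp [annulusCutoff, annulusBump_eq_zero (Or.inl h)]
  have hY1 : ∀ i, ContDiff ℝ ∞ (Y i) := contDiff_radialExt contDiff_annulusCutoff hχ0 hX
  have hY3 : ∀ i, tsupport (Y i) ⊆ ball 0 1 := fun i x hx => by
    have h := tsupport_radialExt_annulusCutoff X i hx
    simp only [Set.mem_ofPred_eq] at h
    rw [mem_ball_zero_iff]
    nlinarith [norm_nonneg x]
  have hY2 : ∀ i, HasCompactSupport (Y i) := fun i =>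
    HasCompactSupport.of_support_subset_isCompact (isCompact_closedBall (0 : Euc n) 1)
      ((subset_tsupport _).trans ((hY3 i).trans ball_subset_closedBall))
  have e1 : ∫ x, P x * ∑ i, pderiv i (Y i) x = ∫ x, ∑ i, f i x * Y i x := by
    simp only [Finset.mul_sum]
    rw [integral_finsetSum, integral_finsetSum]
    · refine Finset.sum_congr rfl fun i _ => ?_
      rw [hw i (Y i) (hY1 i) (hY2 i) (hY3 i), ← integral_neg]
      simp
    · exact fun i _ => integrable_mul_of_integrableOn (hf i) (hY1 i).continuous (hY2 i)
        fun x hx => image_eq_zero_of_notMem_tsupport fun h => hx (hY3 i h)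
    · exact fun i _ => integrable_mul_of_integrableOn hP (continuous_pderiv (hY1 i) i)
        (hasCompactSupport_pderiv (hY2 i) i)
        fun x hx => pderiv_eq_zero_of_notMem_tsupport (fun h => hx (hY3 i h)) i
  have hχ1 : ∀ x : Euc n, x ∉ ball (0 : Euc n) 1 → annulusCutoff (‖x‖ ^ 2) = 0 := fun x hx => by
    have h1 : 1 ≤ ‖x‖ := by simpa using hx
    have : 3 / 4 ≤ ‖x‖ ^ 2 := by nlinarith
    simp [annulusCutoff, annulusBump_eq_zero (Or.inr this)]
  rw [ae_restrict_iff' measurableSet_ball] at hξ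
  -- The radial weights match: P has degree -2 and div Y contributes -1, while f has degree -3 and Y
  -- contributes 0 apart from the cut-off.
  have e2 := integral_eq_radial_mul_sphere (n := n) (g := fun x => P x * ∑ i, pderiv i (Y i) x)
    (a := fun r => annulusCutoff (r ^ 2) * (r ^ 3)⁻¹) (b := fun σ => ξ σ * sphereDiv X σ) (by
      filter_upwards [hξ] with x h1 hx
      rw [hYdef, sum_pderiv_radialExt contDiff_annulusCutoff hX ht hx]
      by_cases hxb : x ∈ ball (0 : Euc n) 1
      · have : ‖x‖ ≠ 0 := norm_ne_zero_iff.2 hx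
        rw [h1 hxb hx]
        field_simp
      · rw [hχ1 x hxb]; ring)
  have hF' : ∀ᵐ x : Euc n, ∀ i, x ∈ ball (0 : Euc n) 1 → ∀ hx : x ≠ 0,
      f i x = F i (direction x hx) / ‖x‖ ^ 3 :=
    ae_all_iff.2 fun i => (ae_restrict_iff' measurableSet_ball).1 (hF i)
  have e3 := integral_eq_radial_mul_sphere (n := n) (g := fun x => ∑ i, f i x * Y i x)
    (a := fun r => annulusCutoff (r ^ 2) * (r ^ 3)⁻¹) (b := fun σ => ∑ i, F i σ * X σ i) (by
      filter_upwards [hF'] with x h1 hx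
      rw [Finset.mul_sum]
      refine Finset.sum_congr rfl fun i _ => ?_
      simp only [hYdef, radialExt]
      by_cases hxb : x ∈ ball (0 : Euc n) 1
      · rw [h1 i hxb hx]
        have : X (direction x hx) = X (‖x‖⁻¹ • x) := rfl
        rw [this]
        ring
      · rw [hχ1 x hxb]; ring)
  rw [e2, e3] at e1
  exact mul_left_cancel₀ radial_integral_ne_zero e1

/-- Tangent fields see only the tangential part of F, so the normal part can be removed. The weak
gradient is minus that tangential part, T - V below. -/
theorem memW1Sphere_of_integral_eq {n : ℕ} {q : ℝ≥0∞} (hq : 1 ≤ q) {ξ : USphere n → ℝ}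
    {F : Fin n → USphere n → ℝ} (hξ : MemLp ξ q (sphereMeasure n))
    (hF : ∀ i, MemLp (F i) q (sphereMeasure n))
    (h : ∀ X : Euc n → Euc n, ContDiff ℝ ∞ X → (∀ σ : USphere n, ⟪X σ, (σ : Euc n)⟫ = 0) →
      ∫ σ, ξ σ * sphereDiv X σ ∂sphereMeasure n = ∫ σ, ∑ i, F i σ * X σ i ∂sphereMeasure n) :
    MemW1Sphere q ξ := by
  set V : USphere n → Euc n := fun σ => WithLp.toLp 2 fun i => F i σ with hV
  have hVL : MemLp V q (sphereMeasure n) := memLp_piLp_iff.2 hF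
  set T : USphere n → Euc n := fun σ => ⟪(σ : Euc n), V σ⟫ • (σ : Euc n) with hT
  have hσm : AEStronglyMeasurable (fun σ : USphere n => (σ : Euc n)) (sphereMeasure n) :=
    continuous_subtype_val.aestronglyMeasurable
  have hTL : MemLp T q (sphereMeasure n) := by
    have hTm : AEStronglyMeasurable T (sphereMeasure n) :=
      (AEStronglyMeasurable.inner (𝕜 := ℝ) hσm hVL.1).smul hσm
    refine hVL.mono hTm (Eventually.of_forall fun σ => ?_)
    have hs : ‖(σ : Euc n)‖ = 1 := by simp
    rw [hT, norm_smul, hs, mul_one]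
    simpa [hs] using norm_inner_le_norm (𝕜 := ℝ) (σ : Euc n) (V σ)
  have hGL : MemLp (fun σ => T σ - V σ) q (sphereMeasure n) := hTL.sub hVL
  refine ⟨hξ, fun σ => T σ - V σ, hGL, hξ.integrable hq, hGL.integrable hq, ?_, fun X hX ht => ?_⟩
  · refine Eventually.of_forall fun σ => ?_
    have hs : ‖(σ : Euc n)‖ = 1 := by simp
    simp only [hT, inner_sub_left, real_inner_smul_left, real_inner_self_eq_norm_sq, hs]
    rw [real_inner_comm]
    ring
  · rw [h X hX ht, ← integral_neg]
    congr 1 with σ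
    rw [inner_sub_left, hT, real_inner_smul_left, real_inner_comm (X σ) (σ : Euc n), ht σ]
    simp [hV, PiLp.inner_apply, mul_comm]

/-! ### The pressure of a homogeneous Euler flow -/

theorem proposition5p4 (h : Euc 5 → Euc 5) (p : Euc 5 → ℝ)
    (hh : MemH 1 h)
    (hp : IntegrableOn p (oball 5 1 : Set (Euc 5)) volume)
    (hdiv : DivFree (oball 5 1) h)
    (hmom : EulerMomentum (oball 5 1) h p) :
    ∃ (p₀ : ℝ) (ξ : USphere 5 → ℝ), MemW1Sphere (5 / 4) ξ ∧
      ∀ᵐ x ∂volume.restrict (oball 5 1 : Set (Euc 5)), ∀ hx : x ≠ 0,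
        p x = ξ (direction x hx) / ‖x‖ ^ 2 + p₀ := by
  have hball : (oball 5 1 : Set (Euc 5)) = ball 0 1 := rfl
  rw [hball] at hp ⊢
  have : IsFiniteMeasure (volume.restrict (ball (0 : Euc 5) 1)) :=
    isFiniteMeasure_restrict.2 measure_ball_lt_top.ne
  -- Sobolev embedding loses the boundary; the half ball suffices because a profile is determined by
  -- any ball about the origin.
  have hsub : volume.restrict (ball (0 : Euc 5) (1 / 2)) ≤ volume.restrict (ball (0 : Euc 5) 1) :=
    Measure.restrict_mono (ball_subset_ball (by norm_num)) le_rfl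
  have hhL : ∀ i, MemLp (fun x => h x i) 2 (volume.restrict (ball 0 1)) := fun i => (hh.1 i).1
  choose G hGL hG using fun i => (hh.1 i).2
  have hGL' : ∀ i j, MemLp (fun x => G i x j) 2 (volume.restrict (ball 0 1)) :=
    fun i => memLp_piLp_iff.1 (hGL i)
  have hGI : ∀ i j, IntegrableOn (fun x => G i x j) (ball 0 1) :=
    fun i j => (hGL' i j).integrable one_le_two
  have hGw : ∀ i j, WeakPDeriv (ball 0 1) j (fun x => h x i) (fun x => G i x j) :=
    fun i j => (hG i).weakPDeriv j
  set f : Fin 5 → Euc 5 → ℝ := fun i x => ∑ j, h x j * G i x j with hf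
  have hfI : ∀ i, IntegrableOn (f i) (ball 0 1) := fun i =>
    integrable_finsetSum _ fun j _ => (hhL j).integrable_mul (hGL' i j)
  have hpw : ∀ i, WeakPDeriv (ball 0 1) i p (fun x => -f i x) := by
    obtain ⟨D, hD, hDeq⟩ := hmom
    -- The gradients in the momentum equation are only locally integrable; by uniqueness they are
    -- the L² gradients from `MemH`.
    have hDG : ∀ i j, (fun x => D i x j) =ᵐ[volume.restrict (ball 0 1)] fun x => G i x j := by
      intro i j
      refine ((hD i).weakPDeriv j).unique isOpen_ball (hGw i j) ?_ (hGI i j).locallyIntegrableOn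
      intro x hx
      obtain ⟨t, ht, hti⟩ := (hD i).locInt_grad x hx
      exact ⟨t, ht, hti.eval_piLp j⟩
    intro i φ h1 h2 h3
    have e := hDeq (mkTest (oball 5 1) φ h1 h2 h3) i
    change (∫ x in ball 0 1, (∑ j, h x j * D i x j) * φ x) -
      ∫ x in ball 0 1, p x * pderiv i φ x = 0 at e
    have e2 : ∫ x in ball 0 1, (∑ j, h x j * D i x j) * φ x = ∫ x in ball 0 1, f i x * φ x := by
      refine integral_congr_ae ?_
      filter_upwards [ae_all_iff.2 (hDG i)] with x hx
      simp only [hf, hx]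
    rw [e2, setIntegral_mul_eq_of_tsupport_subset h3, setIntegral_mul_pderiv_eq h3] at e
    simp only [neg_mul, integral_neg]
    linarith
  have hfh : ∀ i, ∀ c : ℝ, 0 < c → c < 1 →
      ∀ᵐ x ∂volume.restrict (ball 0 1), c ^ 3 * f i (c • x) = f i x := by
    intro i c hc hc1
    have a1 : ∀ᵐ x ∂volume.restrict (ball 0 1), ∀ j, c ^ 1 * h (c • x) j = h x j :=
      ae_all_iff.2 fun j => hh.ae_homogeneous hc hc1 j
    have a2 : ∀ᵐ x ∂volume.restrict (ball 0 1), ∀ j, c ^ 2 * G i (c • x) j = G i x j :=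
      ae_all_iff.2 fun j => (hGw i j).ae_homogeneous (hGI i j) hc hc1 (hh.ae_homogeneous hc hc1 i)
    filter_upwards [a1, a2] with x b1 b2
    simp only [hf, Finset.mul_sum, ← b1, ← b2]
    exact Finset.sum_congr rfl fun j _ => by ring
  obtain ⟨K, hK⟩ := exists_ae_homogeneous_add_const hp (fun i => (hfI i).neg) hpw
    fun i c hc hc1 => by
      filter_upwards [hfh i c hc hc1] with x hx
      rw [Pi.neg_apply, Pi.neg_apply, mul_neg, hx]
  have hPI : IntegrableOn (fun x => p x + K) (ball 0 1) := Integrable.add hp (integrable_const K)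
  have hPw : ∀ i, WeakPDeriv (ball 0 1) i (fun x => p x + K) (fun x => -f i x) := fun i => by
    simpa using (hpw i).sub (weakPDeriv_const i (-K)) hp (integrable_const _) (hfI i).neg
      (integrable_const _)
  have hq : ((5 / 4 : ℝ≥0) : ℝ≥0∞) = 5 / 4 := by
    rw [ENNReal.coe_div (by norm_num)]; norm_num
  have hq1 : (1 : ℝ≥0∞) ≤ ((5 / 4 : ℝ≥0) : ℝ≥0∞) := by
    rw [ENNReal.one_le_coe_iff, ← NNReal.coe_le_coe]; norm_num
  -- Sobolev exponent: 1 - 1/5 = 4/5.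
  have hPL : MemLp (fun x => p x + K) ((5 / 4 : ℝ≥0) : ℝ≥0∞) (volume.restrict (ball 0 (1 / 2))) :=
    memLp_of_weakPDeriv_ball (p := 1) (by norm_num) le_rfl (by norm_num) (by norm_num)
      (by norm_num) (memLp_one_iff_integrable.2 hPI)
      (fun i => memLp_one_iff_integrable.2 (hfI i).neg) hPw
  -- Sobolev exponent: 1/2 - 1/5 = 3/10; then Hölder with the L² gradient gives 3/10 + 1/2 = 4/5.
  have hhS : ∀ i, MemLp (fun x => h x i) ((10 / 3 : ℝ≥0) : ℝ≥0∞)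
      (volume.restrict (ball 0 (1 / 2))) := fun i =>
    memLp_of_weakPDeriv_ball (p := 2) (by norm_num) one_le_two (by norm_num) (by norm_num)
      (by norm_num) (hhL i) (hGL' i) (hGw i)
  have hHolder : ENNReal.HolderTriple ((10 / 3 : ℝ≥0) : ℝ≥0∞) 2 ((5 / 4 : ℝ≥0) : ℝ≥0∞) := by
    constructor
    rw [← ENNReal.coe_inv (by norm_num), ← ENNReal.coe_inv (by norm_num),
      show (2 : ℝ≥0∞) = ((2 : ℝ≥0) : ℝ≥0∞) by norm_num, ← ENNReal.coe_inv (by norm_num),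
      ← ENNReal.coe_add, ENNReal.coe_inj, ← NNReal.coe_inj]
    push_cast
    norm_num
  have hfL : ∀ i, MemLp (f i) ((5 / 4 : ℝ≥0) : ℝ≥0∞) (volume.restrict (ball 0 (1 / 2))) :=
    fun i => memLp_finsetSum _ fun j _ => ((hGL' i j).mono_measure hsub).mul' (hhS j)
  obtain ⟨ξ, hξm, hξ⟩ := exists_sphere_profile hPI.1 hK
  choose F hFm hF using fun i => exists_sphere_profile (hfI i).1 (hfh i)
  have hq0 : ((5 / 4 : ℝ≥0) : ℝ≥0∞) ≠ 0 := (zero_lt_one.trans_le hq1).ne'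
  have hξL := memLp_profile hq0 ENNReal.coe_ne_top (by norm_num) hPL hξm
    (ae_mono hsub hξ)
  have hFL := fun i => memLp_profile hq0 ENNReal.coe_ne_top (by norm_num) (hfL i) (hFm i)
    (ae_mono hsub (hF i))
  refine ⟨-K, ξ, ?_, ?_⟩
  · rw [← hq]
    exact memW1Sphere_of_integral_eq hq1 hξL hFL fun X hX ht =>
      integral_mul_sphereDiv_eq hPI hfI hPw hξ hF hX ht
  · filter_upwards [hξ] with x hx hx0
    rw [← hx hx0]
    ring

end
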